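/- Let $m\ge 1$ and let $A\in\mathbb{R}^{m\times m}$ be a normal matrix, $AA^*=A^*A$, with eigenvalues $\lambda_1,\dots,\lambda_m\in\mathbb{C}$ (counted with multiplicity) ordered such that $0<\mathsf{Re}(\lambda_1)\le\mathsf{Re}(\lambda_2)\le\dots\le\mathsf{Re}(\lambda_m)$, and let $v_1,\dots,v_m$ be an orthonormal basis of $\mathbb{C}^m$ with $Av_j=\lambda_jv_j$. (This includes the case of a positive definite symmetric matrix $A$.) Let $B$ be a standard Brownian motion in $\mathbb{R}^m$ and, for $x\in\mathbb{R}^m$, let $(X_t(x))_{t\ge 0}$ be the solution of $$\mathrm{d}X_t(x)=-AX_t(x)\,\mathrm{d}t+\mathrm{d}B_t,\qquad X_0(x)=x.$$ Let $\mu$ be the stationary probability distribution of this equation. Let $\mathcal{W}_2$ be the Wasserstein distance of order $2$ on $\mathbb{R}^m$, $$\mathcal{W}_2(\mu_1,\mu_2)=\Big(\inf_{\mathcal{T}}\int_{\mathbb{R}^m\times\mathbb{R}^m}|u-v|^2\,\mathcal{T}(\mathrm{d}u,\mathrm{d}v)\Big)^{1/2},$$ the infimum being over all joint distributions $\mathcal{T}$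 of $\mu_1$ and $\mu_2$, where a random variable in place of a measure stands for its law. Fix $x\in\mathbb{R}^m$. Then $\mathcal{W}_2(X_t(x),\mu)<\infty$ for all $t\ge 0$, and the following holds. 1. If $x\ne0$ and $\langle x,v_1\rangle\neq 0$, then for $t_\varepsilon:=\frac{1}{\mathsf{Re}(\lambda_1)}|\ln\varepsilon|$ $$\lim_{\varepsilon\to 0+}\frac{\mathcal{W}_2(X_{\delta\cdot t_\varepsilon}(x),\mu)}{\varepsilon}=\begin{cases}\infty&\text{for }\delta\in(0,1),\\0&\text{for }\delta>1.\end{cases}\qquad(*)$$ 2. If $x\neq 0$, $\langle x,v_1\rangle=0$ and $$\rho:=\min\{\mathsf{Re}(\lambda_j): j\in\{1,\dots,m\},\ \langle x,v_j\rangle\neq 0\}<2\,\mathsf{Re}(\lambda_1),$$ then $(*)$ holds for $t_\varepsilon:=\frac1\rho|\ln\varepsilon|$. 3. If $x=0$, then $(*)$ holds for $t_\varepsilon:=\frac{1}{2\mathsf{Re}(\lambda_1)}|\ln\varepsilon|$. -/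

import Mathlib

open MeasureTheory ProbabilityTheory Filter Topology
open scoped NNReal ENNReal Matrix

noncomputable section

/-- `B` is an `n`-dimensional standard Brownian motion under `P`: its coordinates are independent
real standard Brownian motions (with almost surely continuous paths). -/
structure IsStandardBrownian {Ω : Type*} [MeasurableSpace Ω] {n : ℕ}
    (B : ℝ≥0 → Ω → EuclideanSpace ℝ (Fin n)) (P : Measure Ω) : Prop where
  coord : ∀ i, IsBrownianReal (fun t ω ↦ B t ω i) P
  indep : iIndepFun (fun (i : Fin n) (ω : Ω) (t : ℝ≥0) ↦ B t ω i) P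

/-- `X` is a solution with continuous paths of `dX_t = -A X_t dt + σ dL_t`, `X_0 = x`. The noise is
additive, so the equation is understood in its pathwise integrated form
`X_t = x - ∫_0^t A X_s ds + σ L_t` for all `t ≥ 0`. -/
structure IsOUSolution {Ω : Type*} [MeasurableSpace Ω] {m n : ℕ}
    (A : Matrix (Fin m) (Fin m) ℝ) (σ : Matrix (Fin m) (Fin n) ℝ)
    (L : ℝ≥0 → Ω → EuclideanSpace ℝ (Fin n)) (P : Measure Ω) (x : EuclideanSpace ℝ (Fin m))
    (X : ℝ≥0 → Ω → EuclideanSpace ℝ (Fin m)) : Prop where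
  aemeasurable : ∀ t, AEMeasurable (X t) P
  continuous : ∀ᵐ ω ∂P, Continuous (fun t ↦ X t ω)
  equation : ∀ᵐ ω ∂P, ∀ t : ℝ≥0,
    X t ω = x - (∫ s in (0 : ℝ)..t, A.toEuclideanLin (X s.toNNReal ω)) + σ.toEuclideanLin (L t ω)

/-- `μ` is a stationary (equilibrium) distribution of the Markov family `X`, where `X y` is the
process started in `y`: it is a probability measure and, for every `t`, starting from `μ` the
law at time `t` is `μ` again, i.e. `∫ P(X_t(y) ∈ ·) μ(dy) = μ`. -/
structure IsStationaryLaw {Ω E : Type*} [MeasurableSpace Ω] [MeasurableSpace E]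
    (P : Measure Ω) (X : E → ℝ≥0 → Ω → E) (μ : Measure E) : Prop where
  isProbabilityMeasure : IsProbabilityMeasure μ
  bind_eq : ∀ t, μ.bind (fun y ↦ P.map (X y t)) = μ

/-- The joint distributions (couplings) of `μ₁` and `μ₂`. -/
def couplings {E : Type*} [MeasurableSpace E] (μ₁ μ₂ : Measure E) : Set (Measure (E × E)) :=
  {γ | γ.map Prod.fst = μ₁ ∧ γ.map Prod.snd = μ₂}

/-- The Wasserstein-Kantorovich-Rubinstein distance of order `p > 0`, with values in `[0, ∞]`. -/
def wasserstein {E : Type*} [PseudoEMetricSpace E] [MeasurableSpace E] (p : ℝ)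
    (μ₁ μ₂ : Measure E) : ℝ≥0∞ :=
  (⨅ γ ∈ couplings μ₁ μ₂, ∫⁻ z, edist z.1 z.2 ^ p ∂γ) ^ min 1 (1 / p)

/-- Cutoff stability of the distance function `d` (distance to equilibrium as a function of time)
at the time scale `T`: as `ε → 0`, `ε > 0`, the quotient `d (δ * T ε) / ε` tends to `∞`
for `δ ∈ (0, 1)` and to `0` for `δ > 1`. -/
def CutoffStability (d : ℝ≥0 → ℝ) (T : ℝ → ℝ) : Prop :=
  (∀ δ : ℝ, 0 < δ → δ < 1 →
    Tendsto (fun ε : ℝ ↦ d (δ * T ε).toNNReal / ε) (𝓝[>] 0) atTop) ∧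
  (∀ δ : ℝ, 1 < δ →
    Tendsto (fun ε : ℝ ↦ d (δ * T ε).toNNReal / ε) (𝓝[>] 0) (𝓝 0))

/-- A real vector, seen in `ℂ^m`. -/
def toComplexVec {m : ℕ} (x : EuclideanSpace ℝ (Fin m)) : EuclideanSpace ℂ (Fin m) :=
  WithLp.toLp 2 (fun i ↦ (x i : ℂ))

end

/-! Write S_t = exp(-tA). The law of X_t(x) is Gaussian with mean S_t x and covariance ∫₀ᵗ S_r S_r*
dr. The matrix A + A* is real symmetric with eigenvalues 2 Re λ_j, and a real orthonormal eigenbasis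
`w` of it diagonalises this covariance for every t at once, with entries (1 - exp(-s_k t))/s_k
(`exists_real_eigenbasis`, `IsOUSolution.charFun_map_eq_diagGaussian`). Letting t → ∞ in the
invariance relation identifies μ as the centred Gaussian with entries 1/s_k
(`IsStationaryLaw.charFun_eq_diagGaussian`).

Two Gaussians diagonal in the same basis are coupled by an affine map, which gives W₂ ≤ 2|S_t x| + C
exp(-2 Re(λ₁) t) (`wasserstein_diagGaussian_le`). Conversely W₂ ≥ |S_t x|
(`norm_mean_le_wasserstein`), and for centred laws W₂ is at least a constant times each variance
defect exp(-s_k t) (`sqrt_mul_le_wasserstein`).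

The mean decays exactly like exp(-ρt), with ρ the least real part seen by x. Hence W₂ is comparable
to exp(-rt), where r = ρ in cases 1 and 2 and r = 2 Re λ₁ for x = 0. Two-sided bounds of this kind
give cutoff at |ln ε|/r (`cutoffStability_of_exp_bounds`). -/

/-! ### Riemann-Stieltjes sums and Wiener integrals -/

/-- Each summand is the integral of a frozen value of f against h' over one cell, so uniform
continuity of f controls the error. The parameter r selects left (0) or right (1) endpoints; both
are needed below. -/
lemma tendsto_riemannStieltjes_sum {f h h' : ℝ → ℝ} (hf : Continuous f) (hh' : Continuous h')
    (hh : ∀ s, HasDerivAt h (h' s) s) {t : ℝ} (ht : 0 ≤ t) (r : ℕ) (hr : r ≤ 1) :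
    Tendsto (fun n : ℕ ↦ ∑ k ∈ Finset.range n, f (t * (k + r : ℕ) / n) *
      (h (t * (k + 1 : ℕ) / n) - h (t * k / n))) atTop (𝓝 (∫ s in (0 : ℝ)..t, f s * h' s)) := by
  obtain ⟨M, hM⟩ := isCompact_Icc.exists_bound_of_continuousOn
    (s := Set.Icc 0 t) hh'.continuousOn
  have hM0 : 0 ≤ M := (norm_nonneg _).trans (hM 0 ⟨le_rfl, ht⟩)
  have huc : UniformContinuousOn f (Set.Icc 0 t) :=
    isCompact_Icc.uniformContinuousOn_of_continuous hf.continuousOn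
  rw [Metric.tendsto_atTop]
  intro ε hε
  set η : ℝ := ε / (2 * (M * t + 1)) with hη
  have hMt : 0 ≤ M * t := mul_nonneg hM0 ht
  have hη0 : 0 < η := by positivity
  obtain ⟨δ, hδ, hfδ⟩ := Metric.uniformContinuousOn_iff.1 huc η hη0
  obtain ⟨N, hN⟩ := exists_nat_gt (t / δ)
  refine ⟨N + 1, fun n hn ↦ ?_⟩
  have hn0 : (0 : ℝ) < n := by exact_mod_cast (by omega : 0 < n)
  have hnt : t / n < δ := by
    have : t / δ < n := hN.trans (by exact_mod_cast (by omega : N < n))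
    rw [div_lt_iff₀ hδ] at this
    rw [div_lt_iff₀ hn0]
    linarith
  have hint : ∀ a b, IntervalIntegrable (fun s ↦ f s * h' s) volume a b := fun a b ↦
    (hf.mul hh').intervalIntegrable a b
  have hsum : ∫ s in (0 : ℝ)..t, f s * h' s =
      ∑ k ∈ Finset.range n, ∫ s in (t * k / n)..(t * (k + 1 : ℕ) / n), f s * h' s := by
    have := intervalIntegral.sum_integral_adjacent_intervals (μ := volume)
      (f := fun s ↦ f s * h' s) (a := fun k : ℕ ↦ t * k / n) (n := n) (fun k _ ↦ hint _ _)
    rw [this]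
    congr 1
    · simp
    · field_simp
  have hterm : ∀ k : ℕ, f (t * (k + r : ℕ) / n) *
      (h (t * (k + 1 : ℕ) / n) - h (t * k / n)) =
      ∫ s in (t * k / n)..(t * (k + 1 : ℕ) / n), f (t * (k + r : ℕ) / n) * h' s := by
    intro k
    rw [intervalIntegral.integral_const_mul, intervalIntegral.integral_eq_sub_of_hasDerivAt
      (fun s _ ↦ hh s) (hh'.intervalIntegrable _ _)]
  rw [dist_eq_norm, hsum, ← Finset.sum_sub_distrib]
  have hle : ∀ k ∈ Finset.range n, ‖f (t * (k + r : ℕ) / n) *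
      (h (t * (k + 1 : ℕ) / n) - h (t * k / n)) -
      ∫ s in (t * k / n)..(t * (k + 1 : ℕ) / n), f s * h' s‖ ≤ η * M * (t / n) := by
    intro k hk
    have hk' : (k : ℝ) + 1 ≤ n := by exact_mod_cast Finset.mem_range.1 hk
    have hr' : (r : ℝ) ≤ 1 := by exact_mod_cast hr
    rw [hterm, ← intervalIntegral.integral_sub ((hh'.const_mul _).intervalIntegrable _ _)
      (hint _ _)]
    have hab : t * k / n ≤ t * (k + 1 : ℕ) / n := by
      gcongr; omega
    have hlen : t * (k + 1 : ℕ) / n - t * k / n = t / n := by push_cast; ring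
    have hmemlo : t * k / n ≤ t * (k + r : ℕ) / n := by gcongr; omega
    have hmemhi : t * (k + r : ℕ) / n ≤ t * (k + 1 : ℕ) / n := by gcongr
    have hlo : 0 ≤ t * k / n := by positivity
    have hhi : t * (k + 1 : ℕ) / n ≤ t := by
      rw [div_le_iff₀ hn0]; push_cast; exact mul_le_mul_of_nonneg_left hk' ht
    refine (intervalIntegral.norm_integral_le_of_norm_le_const (C := η * M) ?_).trans ?_
    · intro s hs
      rw [Set.uIoc_of_le hab] at hs
      have hs' : s ∈ Set.Icc 0 t := ⟨hlo.trans hs.1.le, hs.2.trans hhi⟩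
      rw [← sub_mul, norm_mul]
      refine mul_le_mul ?_ (hM s hs') (norm_nonneg _) hη0.le
      rw [← dist_eq_norm]
      refine (hfδ _ ⟨hlo.trans hmemlo, hmemhi.trans hhi⟩ _ hs' ?_).le
      rw [Real.dist_eq, abs_lt]
      constructor <;> linarith [hs.1, hs.2]
    · rw [hlen, abs_of_nonneg (by positivity)]
  refine ((norm_sum_le _ _).trans (Finset.sum_le_sum hle)).trans_lt ?_
  rw [Finset.sum_const, Finset.card_range, nsmul_eq_mul]
  have : (n : ℝ) * (η * M * (t / n)) = η * (M * t) := by field_simp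
  rw [this, hη, div_mul_eq_mul_div, div_lt_iff₀ (by positivity)]
  nlinarith

/-- Summation by parts for Riemann-Stieltjes sums. -/
lemma tendsto_stieltjes_sum {b g g' : ℝ → ℝ} (hb : Continuous b) (hb0 : b 0 = 0)
    (hg' : Continuous g') (hg : ∀ s, HasDerivAt g (g' s) s) {t : ℝ} (ht : 0 ≤ t) :
    Tendsto (fun n : ℕ ↦ ∑ k ∈ Finset.range n, g (t * k / n) *
      (b (t * (k + 1 : ℕ) / n) - b (t * k / n))) atTop
      (𝓝 (g t * b t - ∫ s in (0 : ℝ)..t, b s * g' s)) := by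
  -- Abel summation moves the increments from b, which is merely continuous, onto g, and leaves b
  -- evaluated at right endpoints; hence r = 1.
  refine ((tendsto_const_nhds (x := g t * b t)).sub
    (tendsto_riemannStieltjes_sum hb hg' hg ht 1 le_rfl)).congr' ?_
  filter_upwards [eventually_gt_atTop 0] with n hn
  have hn0 : (n : ℝ) ≠ 0 := by exact_mod_cast hn.ne'
  have hs := Finset.sum_range_sub (fun k : ℕ ↦ g (t * k / n) * b (t * k / n)) n
  simp only [Nat.cast_zero, mul_zero, zero_div, hb0, sub_zero, mul_div_assoc, div_self hn0,
    mul_one] at hs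
  rw [← hs, ← Finset.sum_sub_distrib]
  refine Finset.sum_congr rfl fun k _ ↦ ?_
  simp only [mul_div_assoc]
  ring

lemma charFun_hasLaw_gaussianReal {Ω : Type*} [MeasurableSpace Ω] {P : Measure Ω} {Y : Ω → ℝ}
    {v : ℝ≥0} (h : HasLaw Y (gaussianReal 0 v) P) (c : ℝ) :
    ∫ ω, Complex.exp ((c * Y ω : ℝ) * Complex.I) ∂P = Complex.exp (-(v * c ^ 2 / 2 : ℝ)) := by
  have := charFun_gaussianReal (μ := 0) (v := v) c
  rw [charFun_apply_real, ← h.map_eq, integral_map h.aemeasurable (by fun_prop)] at this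
  simp only [Complex.ofReal_mul, this]
  congr 1
  push_cast
  ring

/-- The characteristic function of a Riemann-Stieltjes sum against Brownian increments. -/
lemma integral_exp_brownian_sum {Ω : Type*} [MeasurableSpace Ω] {P : Measure Ω}
    {b : ℝ≥0 → Ω → ℝ} (hb : IsPreBrownianReal b P) (c : ℕ → ℝ) (t : ℝ≥0) (n : ℕ) :
    ∫ ω, Complex.exp ((∑ k ∈ Finset.range n, c k *
      (b (t * (k + 1 : ℕ) / n) ω - b (t * k / n) ω) : ℝ) * Complex.I) ∂P =
      Complex.exp (-((∑ k ∈ Finset.range n, c k ^ 2 * (t / n) : ℝ) / 2 : ℝ)) := by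
  have hmono : Monotone (fun k : ℕ ↦ t * (k : ℝ≥0) / (n : ℝ≥0)) := by
    intro i j hij
    dsimp only
    gcongr
  have hind := hb.hasIndepIncrements.nat hmono
  have hm : ∀ k : ℕ, AEMeasurable (fun ω ↦ b (t * (k + 1 : ℕ) / n) ω - b (t * k / n) ω) P :=
    fun k ↦ (hb.aemeasurable _).sub (hb.aemeasurable _)
  have hlaw : ∀ k : ℕ, HasLaw (fun ω ↦ b (t * (k + 1 : ℕ) / n) ω - b (t * k / n) ω)
      (gaussianReal 0 (t / n)) P := by
    intro k
    have hv : t / n = nndist ((t * (k + 1 : ℕ) / n : ℝ≥0) : ℝ) (t * k / n : ℝ≥0) := by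
      rw [← NNReal.coe_inj, coe_nndist, Real.dist_eq]
      push_cast
      rw [show ((t : ℝ) * (k + 1) / n - t * k / n) = t / n by ring, abs_of_nonneg (by positivity)]
    rw [hv]
    exact hb.hasLaw_sub (t * (k + 1 : ℕ) / n) (t * k / n)
  have hind' := hind.precomp (g := fun i : Fin n ↦ (i : ℕ)) Fin.val_injective
  have hprod := hind'.integral_fun_prod_comp (f := fun (i : Fin n) (y : ℝ) ↦
    Complex.exp ((c i * y : ℝ) * Complex.I)) (fun i ↦ hm i)
    (fun i ↦ by fun_prop)
  have hL : ∀ ω, Complex.exp ((∑ k ∈ Finset.range n, c k *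
      (b (t * (k + 1 : ℕ) / n) ω - b (t * k / n) ω) : ℝ) * Complex.I) =
      ∏ i : Fin n, Complex.exp ((c i * (b (t * ((i : ℕ) + 1 : ℕ) / n) ω -
        b (t * (i : ℕ) / n) ω) : ℝ) * Complex.I) := by
    intro ω
    rw [← Complex.exp_sum, ← Finset.sum_mul, Finset.sum_range]
    push_cast
    rfl
  simp_rw [hL]
  rw [hprod]
  simp_rw [charFun_hasLaw_gaussianReal (hlaw _)]
  rw [← Complex.exp_sum, Finset.sum_range]
  congr 1
  push_cast
  rw [Finset.sum_neg_distrib, Finset.sum_div]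
  congr 1
  refine Finset.sum_congr rfl fun i _ ↦ ?_
  ring

lemma IsStandardBrownian.aemeasurable_mul_sub {Ω : Type*} [MeasurableSpace Ω] {P : Measure Ω}
    {m : ℕ} {B : ℝ≥0 → Ω → EuclideanSpace ℝ (Fin m)} (hB : IsStandardBrownian B P) (c : ℝ)
    (s r : ℝ≥0) (i : Fin m) : AEMeasurable (fun ω ↦ c * (B s ω i - B r ω i)) P := by
  have hs : AEMeasurable (fun ω ↦ (B s ω i : ℝ)) P :=
    (hB.coord i).toIsPreBrownianReal.aemeasurable s
  have hr : AEMeasurable (fun ω ↦ (B r ω i : ℝ)) P :=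
    (hB.coord i).toIsPreBrownianReal.aemeasurable r
  exact AEMeasurable.const_mul (AEMeasurable.sub (G := ℝ) hs hr) c

/-- Independence of the coordinates factors the expectation, and the one-dimensional variances add
up to squared Euclidean norms. -/
lemma integral_exp_standardBrownian_sum {Ω : Type*} [MeasurableSpace Ω] {P : Measure Ω} {m : ℕ}
    {B : ℝ≥0 → Ω → EuclideanSpace ℝ (Fin m)} (hB : IsStandardBrownian B P)
    (c : ℕ → EuclideanSpace ℝ (Fin m)) (t : ℝ≥0) (n : ℕ) :
    ∫ ω, Complex.exp ((∑ i, ∑ k ∈ Finset.range n, c k i *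
      (B (t * (k + 1 : ℕ) / n) ω i - B (t * k / n) ω i) : ℝ) * Complex.I) ∂P =
      Complex.exp (-((∑ k ∈ Finset.range n, ‖c k‖ ^ 2 * (t / n) : ℝ) / 2 : ℝ)) := by
  have hind := hB.indep.comp (fun i (y : ℝ≥0 → ℝ) ↦ ∑ k ∈ Finset.range n, c k i *
      (y (t * (k + 1 : ℕ) / n) - y (t * k / n))) (fun i ↦ by fun_prop)
  have hprod := hind.integral_fun_prod_comp (f := fun _ (y : ℝ) ↦
    Complex.exp ((y : ℝ) * Complex.I)) (fun i ↦ by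
      simp only [Function.comp_def]
      exact Finset.aemeasurable_fun_sum _ fun k _ ↦ hB.aemeasurable_mul_sub _ _ _ _)
    (fun i ↦ by fun_prop)
  simp only [Function.comp_def] at hprod
  have hL : ∀ ω, Complex.exp ((∑ i, ∑ k ∈ Finset.range n, c k i *
      (B (t * (k + 1 : ℕ) / n) ω i - B (t * k / n) ω i) : ℝ) * Complex.I) =
      ∏ i, Complex.exp ((∑ k ∈ Finset.range n, c k i *
      (B (t * (k + 1 : ℕ) / n) ω i - B (t * k / n) ω i) : ℝ) * Complex.I) := by
    intro ω
    rw [← Complex.exp_sum, ← Finset.sum_mul]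
    push_cast
    rfl
  simp_rw [hL]
  rw [hprod]
  simp_rw [fun i ↦ integral_exp_brownian_sum (hB.coord i).toIsPreBrownianReal (fun k ↦ c k i) t n]
  rw [← Complex.exp_sum]
  congr 1
  norm_cast
  rw [Finset.sum_neg_distrib, ← Finset.sum_div, Finset.sum_comm]
  simp_rw [← Finset.sum_mul, EuclideanSpace.real_norm_sq_eq]

/-- The characteristic function of the Wiener integral `∫₀ᵗ ⟨g, dB⟩` of a `C¹` function `g`,
written by means of an integration by parts. -/
lemma integral_exp_wiener {Ω : Type*} [MeasurableSpace Ω] {P : Measure Ω} [IsProbabilityMeasure P]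
    {m : ℕ} {B : ℝ≥0 → Ω → EuclideanSpace ℝ (Fin m)} (hB : IsStandardBrownian B P)
    {g g' : ℝ → EuclideanSpace ℝ (Fin m)} (hg : ∀ s, HasDerivAt g (g' s) s)
    (hg' : Continuous g') (t : ℝ≥0) :
    ∫ ω, Complex.exp ((inner ℝ (B t ω) (g t) -
      ∫ s in (0 : ℝ)..t, inner ℝ (B s.toNNReal ω) (g' s) : ℝ) * Complex.I) ∂P =
      Complex.exp (-((∫ s in (0 : ℝ)..t, ‖g s‖ ^ 2) / 2 : ℝ)) := by
  have hgc : Continuous g := continuous_iff_continuousAt.2 fun s ↦ (hg s).continuousAt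
  have hgi : ∀ i s, HasDerivAt (fun s ↦ g s i) (g' s i) s := fun i s ↦
    (EuclideanSpace.proj (𝕜 := ℝ) i).hasFDerivAt.comp_hasDerivAt s (hg s)
  have hlim : Tendsto (fun n : ℕ ↦ ∫ ω, Complex.exp ((∑ i, ∑ k ∈ Finset.range n,
      g (t * k / n) i * (B (t * (k + 1 : ℕ) / n) ω i - B (t * k / n) ω i) : ℝ) * Complex.I) ∂P)
      atTop (𝓝 (∫ ω, Complex.exp ((inner ℝ (B t ω) (g t) -
      ∫ s in (0 : ℝ)..t, inner ℝ (B s.toNNReal ω) (g' s) : ℝ) * Complex.I) ∂P)) := by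
    refine tendsto_integral_of_dominated_convergence (fun _ ↦ 1) (fun n ↦ ?_)
      (integrable_const _) (fun n ↦ ?_) ?_
    · refine AEMeasurable.aestronglyMeasurable ?_
      refine Complex.measurable_exp.comp_aemeasurable (AEMeasurable.mul_const ?_ _)
      refine Complex.measurable_ofReal.comp_aemeasurable ?_
      exact Finset.aemeasurable_fun_sum _ fun i _ ↦
        Finset.aemeasurable_fun_sum _ fun k _ ↦ hB.aemeasurable_mul_sub _ _ _ _
    · exact ae_of_all _ fun ω ↦ (Complex.norm_exp_ofReal_mul_I _).le
    · have h0 : ∀ᵐ ω ∂P, ∀ i, B 0 ω i = 0 := ae_all_iff.2 fun i ↦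
        (hB.coord i).toIsPreBrownianReal.eval_zero_ae_eq_zero
      have hc : ∀ᵐ ω ∂P, ∀ i, Continuous (fun s ↦ B s ω i) := ae_all_iff.2 fun i ↦
        (hB.coord i).cont
      filter_upwards [h0, hc] with ω h0 hc
      have hci : ∀ i, Continuous (fun s : ℝ ↦ B s.toNNReal ω i) := fun i ↦
        (hc i).comp continuous_real_toNNReal
      refine ((Complex.continuous_exp.comp
        (Complex.continuous_ofReal.mul continuous_const)).tendsto _).comp ?_
      have heq : (inner ℝ (B t ω) (g t) -
          ∫ s in (0 : ℝ)..t, inner ℝ (B s.toNNReal ω) (g' s) : ℝ) =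
          ∑ i, (g t i * B (t : ℝ).toNNReal ω i - ∫ s in (0 : ℝ)..t, B s.toNNReal ω i * g' s i) := by
        rw [Finset.sum_sub_distrib, ← intervalIntegral.integral_finsetSum]
        · simp [PiLp.inner_apply, mul_comm]
        · intro i _
          exact ((hci i).mul (by fun_prop)).intervalIntegrable _ _
      rw [heq]
      refine tendsto_finsetSum _ fun i _ ↦ ?_
      have := tendsto_stieltjes_sum (b := fun s : ℝ ↦ B s.toNNReal ω i) (hci i) (by simp [h0])
        (by fun_prop) (hgi i) t.coe_nonneg
      refine this.congr fun n ↦ Finset.sum_congr rfl fun k _ ↦ ?_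
      have e1 : ((t : ℝ) * (k + 1 : ℕ) / n).toNNReal = t * (k + 1 : ℕ) / n := by
        rw [← Real.toNNReal_coe (r := t * (k + 1 : ℕ) / n)]
        push_cast
        rfl
      have e2 : ((t : ℝ) * k / n).toNNReal = t * k / n := by
        rw [← Real.toNNReal_coe (r := t * k / n)]
        push_cast
        rfl
      change g (t * k / n) i * (B ((t : ℝ) * (k + 1 : ℕ) / n).toNNReal ω i -
        B ((t : ℝ) * k / n).toNNReal ω i) = _
      rw [e1, e2]
  simp_rw [fun n : ℕ ↦ integral_exp_standardBrownian_sum hB (fun k ↦ g (t * k / n)) t n] at hlim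
  refine tendsto_nhds_unique hlim ?_
  -- The variances of the discrete sums are left-endpoint Riemann sums of ‖g‖²: r = 0 and h the
  -- identity.
  have hR := tendsto_riemannStieltjes_sum (f := fun s ↦ ‖g s‖ ^ 2) (h := id) (h' := fun _ ↦ 1)
    (by fun_prop) continuous_const (fun s ↦ hasDerivAt_id s) t.coe_nonneg 0 zero_le_one
  simp only [mul_one, add_zero, id] at hR
  have hc : Continuous fun r : ℝ ↦ Complex.exp (-(r / 2 : ℝ)) := by fun_prop
  refine ((hc.tendsto _).comp hR).congr fun n ↦ ?_
  simp only [Function.comp]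
  congr 4
  refine Finset.sum_congr rfl fun k _ ↦ ?_
  congr 1
  push_cast
  ring

/-! ### The linear flow and variation of constants -/

section Flow

variable {E : Type*} [NormedAddCommGroup E] [InnerProductSpace ℝ E]

/-- The flow of `ẏ = -T y`. -/
noncomputable def decayFlow (T : E →L[ℝ] E) (t : ℝ) : E →L[ℝ] E := NormedSpace.exp (t • (-T))

@[simp] lemma decayFlow_zero (T : E →L[ℝ] E) : decayFlow T 0 = 1 := by simp [decayFlow]

variable [CompleteSpace E]

lemma hasDerivAt_decayFlow (T : E →L[ℝ] E) (t : ℝ) :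
    HasDerivAt (decayFlow T) (-(T * decayFlow T t)) t := by
  have := hasDerivAt_exp_smul_const' (𝕂 := ℝ) (-T) t
  rwa [neg_mul] at this

lemma hasDerivAt_decayFlow_apply (T : E →L[ℝ] E) (y : E) (t : ℝ) :
    HasDerivAt (fun t ↦ decayFlow T t y) (-(T (decayFlow T t y))) t := by
  simpa using (hasDerivAt_decayFlow T t).clm_apply (hasDerivAt_const t y)

lemma hasDerivAt_decayFlow_const_sub_apply (T : E →L[ℝ] E) (y : E) (t s : ℝ) :
    HasDerivAt (fun s ↦ decayFlow T (t - s) y) (T (decayFlow T (t - s) y)) s := by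
  simpa using (hasDerivAt_decayFlow_apply T y (t - s)).comp_const_sub t s

lemma adjoint_decayFlow (T : E →L[ℝ] E) (t : ℝ) :
    (decayFlow T t).adjoint = decayFlow T.adjoint t := by
  have := NormedSpace.star_exp (t • (-T))
  simpa [decayFlow, ContinuousLinearMap.star_eq_adjoint] using this

/-- A variation-of-constants formula, tested against a vector `u`, for
`X_t = x - ∫_0^t T X_s ds + b_t`. -/
lemma inner_eq_of_integral_equation [FiniteDimensional ℝ E] (T : E →L[ℝ] E) (x u : E)
    {X b : ℝ → E} (hX : Continuous X) (hb : Continuous b) {t : ℝ} (ht : 0 ≤ t)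
    (h : ∀ s ∈ Set.Icc 0 t, X s = x - (∫ r in (0 : ℝ)..s, T (X r)) + b s) :
    inner ℝ (X t) u = inner ℝ x (decayFlow T.adjoint t u) + (inner ℝ (b t) u -
      ∫ s in (0 : ℝ)..t, inner ℝ (b s) (T.adjoint (decayFlow T.adjoint (t - s) u))) := by
  -- X is no smoother than b, so the product rule is applied to its primitive W instead.
  set W : ℝ → E := fun s ↦ ∫ r in (0 : ℝ)..s, X r with hW
  have hTW : ∀ s, ∫ r in (0 : ℝ)..s, T (X r) = T (W s) := fun s ↦
    T.intervalIntegral_comp_comm (hX.intervalIntegrable _ _)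
  have hWd : ∀ s, HasDerivAt W (X s) s := fun s ↦
    intervalIntegral.integral_hasDerivAt_right (hX.intervalIntegrable _ _)
      hX.aestronglyMeasurable.stronglyMeasurableAtFilter hX.continuousAt
  have hGd : ∀ y s, HasDerivAt (fun s ↦ decayFlow T.adjoint (t - s) y)
      (T.adjoint (decayFlow T.adjoint (t - s) y)) s :=
    fun y s ↦ hasDerivAt_decayFlow_const_sub_apply T.adjoint y t s
  have hcomm : ∀ s, decayFlow T.adjoint s (T.adjoint u) = T.adjoint (decayFlow T.adjoint s u) := by
    intro s
    have : Commute (decayFlow T.adjoint s) T.adjoint := by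
      unfold decayFlow
      exact (((Commute.refl _).neg_left).smul_left s).exp_left
    exact DFunLike.congr_fun this.eq u
  set G : ℝ → E := fun s ↦ T.adjoint (decayFlow T.adjoint (t - s) u) with hG
  have hGc : Continuous G := T.adjoint.continuous.comp
    (continuous_iff_continuousAt.2 fun s ↦ (hGd u s).continuousAt)
  have hGd' : ∀ s, HasDerivAt G (T.adjoint (G s)) s := by
    intro s
    have := hGd (T.adjoint u) s
    simp only [hcomm] at this
    exact this
  have hbi : IntervalIntegrable (fun s ↦ inner ℝ (b s) (G s)) volume 0 t :=
    (hb.inner hGc).intervalIntegrable _ _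
  have hxi : IntervalIntegrable (fun s ↦ inner ℝ x (G s)) volume 0 t :=
    (continuous_const.inner hGc).intervalIntegrable _ _
  -- Since G' = T*G, the derivative of ⟨W, G⟩ is ⟨X, G⟩ + ⟨TW, G⟩, and the integral equation cancels
  -- the TW terms.
  have hφ : ∫ s in (0 : ℝ)..t, inner ℝ x (G s) + inner ℝ (b s) (G s) =
      inner ℝ (W t) (G t) - inner ℝ (W 0) (G 0) := by
    refine intervalIntegral.integral_eq_sub_of_hasDerivAt (f := fun s ↦ inner ℝ (W s) (G s))
      (fun s hs ↦ ?_) (hxi.add hbi)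
    rw [Set.uIcc_of_le ht] at hs
    have := (hWd s).inner ℝ (hGd' s)
    refine this.congr_deriv ?_
    rw [h s hs, hTW, ContinuousLinearMap.adjoint_inner_right, inner_add_left, inner_sub_left]
    ring
  have hψ : ∫ s in (0 : ℝ)..t, inner ℝ x (G s) =
      inner ℝ x u - inner ℝ x (decayFlow T.adjoint t u) := by
    have := intervalIntegral.integral_eq_sub_of_hasDerivAt
      (f := fun s ↦ inner ℝ x (decayFlow T.adjoint (t - s) u)) (a := 0) (b := t)
      (fun s _ ↦ by simpa using (hasDerivAt_const s x).inner ℝ (hGd u s)) hxi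
    simpa using this
  have hW0 : W 0 = 0 := by simp [hW]
  have hGt : G t = T.adjoint u := by simp [hG]
  rw [intervalIntegral.integral_add hxi hbi, hψ, hW0, hGt, inner_zero_left, sub_zero,
    ContinuousLinearMap.adjoint_inner_right] at hφ
  rw [h t ⟨ht, le_rfl⟩, hTW, inner_add_left, inner_sub_left]
  linarith

end Flow

/-- Variation of constants splits ⟨X_t, u⟩ into a deterministic term and the Wiener integral of s ↦
S_{t-s}* u; `integral_exp_wiener` and time reversal give its variance. -/
lemma IsOUSolution.charFun_map {Ω : Type*} [MeasurableSpace Ω] {P : Measure Ω}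
    [IsProbabilityMeasure P] {m : ℕ} {A : Matrix (Fin m) (Fin m) ℝ}
    {B : ℝ≥0 → Ω → EuclideanSpace ℝ (Fin m)} (hB : IsStandardBrownian B P)
    {x : EuclideanSpace ℝ (Fin m)} {X : ℝ≥0 → Ω → EuclideanSpace ℝ (Fin m)}
    (hX : IsOUSolution A (1 : Matrix (Fin m) (Fin m) ℝ) B P x X)
    {T : EuclideanSpace ℝ (Fin m) →L[ℝ] EuclideanSpace ℝ (Fin m)}
    (hT : ∀ y, A.toEuclideanLin y = T y) (t : ℝ≥0) (u : EuclideanSpace ℝ (Fin m)) :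
    charFun (P.map (X t)) u = Complex.exp ((inner ℝ (decayFlow T t x) u : ℝ) * Complex.I -
      ((∫ s in (0 : ℝ)..t, ‖decayFlow T.adjoint s u‖ ^ 2) / 2 : ℝ)) := by
  have hgd : ∀ s, HasDerivAt (fun s ↦ decayFlow T.adjoint (t - s) u)
      (T.adjoint (decayFlow T.adjoint (t - s) u)) s :=
    fun s ↦ hasDerivAt_decayFlow_const_sub_apply T.adjoint u t s
  have hgc : Continuous fun s : ℝ ↦ T.adjoint (decayFlow T.adjoint (t - s) u) :=
    T.adjoint.continuous.comp (continuous_iff_continuousAt.2 fun s ↦ (hgd s).continuousAt)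
  have hw := integral_exp_wiener hB hgd hgc t
  simp only [sub_self, decayFlow_zero, one_apply_eq_self] at hw
  rw [intervalIntegral.integral_comp_sub_left (fun s ↦ ‖decayFlow T.adjoint s u‖ ^ 2) (t : ℝ),
    sub_self, sub_zero] at hw
  rw [charFun_apply, integral_map (hX.aemeasurable t) (by fun_prop), sub_eq_add_neg, Complex.exp_add,
    ← hw, ← integral_const_mul]
  refine integral_congr_ae ?_
  have hc : ∀ᵐ ω ∂P, ∀ i, Continuous (fun s ↦ B s ω i) := ae_all_iff.2 fun i ↦ (hB.coord i).cont
  filter_upwards [hc, hX.continuous, hX.equation] with ω hc hXc hXe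
  rw [← Complex.exp_add, ← add_mul]
  have hBc : Continuous fun s : ℝ ↦ B s.toNNReal ω :=
    ((PiLp.continuous_toLp 2 _).comp (continuous_pi hc)).comp continuous_real_toNNReal
  have := inner_eq_of_integral_equation T x u (hXc.comp continuous_real_toNNReal) hBc
    t.coe_nonneg (fun s hs ↦ by
      have := hXe s.toNNReal
      simp only [hT, Real.coe_toNNReal s hs.1] at this
      simpa using this)
  simp only [Function.comp, Real.toNNReal_coe] at this
  rw [this, ← adjoint_decayFlow, ContinuousLinearMap.adjoint_inner_right]
  push_cast
  simp

/-! ### Complex eigencoordinates and a real eigenbasis -/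

/-- The function s ↦ exp(cs) L(S_s y) has zero derivative. -/
lemma apply_decayFlow_of_eigen {E : Type*} [NormedAddCommGroup E] [InnerProductSpace ℝ E]
    [CompleteSpace E] {T : E →L[ℝ] E} {L : E →L[ℝ] ℂ} {c : ℂ} (hL : ∀ y, L (T y) = c * L y)
    (t : ℝ) (y : E) : L (decayFlow T t y) = Complex.exp (-(c * t)) * L y := by
  have hd : ∀ s, HasDerivAt (fun s : ℝ ↦ Complex.exp (c * s) * L (decayFlow T s y)) 0 s := by
    intro s
    have h1 : HasDerivAt (fun s : ℝ ↦ Complex.exp (c * s)) (Complex.exp (c * s) * c) s := by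
      have := ((hasDerivAt_id (s : ℂ)).const_mul c).cexp.comp_ofReal
      simpa using this
    have h2 := L.hasFDerivAt.comp_hasDerivAt s (hasDerivAt_decayFlow_apply T y s)
    refine (h1.mul h2).congr_deriv ?_
    simp only [Function.comp, map_neg, hL]
    ring
  have := is_const_of_deriv_eq_zero (fun s ↦ (hd s).differentiableAt) (fun s ↦ (hd s).deriv) t 0
  simp only [Complex.ofReal_zero, mul_zero, Complex.exp_zero, decayFlow_zero, one_mul,
    one_apply_eq_self] at this
  rw [← this, ← mul_assoc, ← Complex.exp_add]
  simp

lemma norm_sq_apply_decayFlow_of_eigen {E : Type*} [NormedAddCommGroup E] [InnerProductSpace ℝ E]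
    [CompleteSpace E] {T : E →L[ℝ] E} {L : E →L[ℝ] ℂ} {c : ℂ} (hL : ∀ y, L (T y) = c * L y)
    (t : ℝ) (y : E) : ‖L (decayFlow T t y)‖ ^ 2 = Real.exp (-(2 * c.re * t)) * ‖L y‖ ^ 2 := by
  rw [apply_decayFlow_of_eigen hL, norm_mul, mul_pow, Complex.norm_exp, ← Real.exp_nat_mul]
  congr 2
  simp
  ring

section Coord

variable {m : ℕ}

/-- The complex coordinate `⟨v, y⟩` of a real vector `y`. -/
noncomputable def complexCoord (v : EuclideanSpace ℂ (Fin m)) :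
    EuclideanSpace ℝ (Fin m) →L[ℝ] ℂ :=
  LinearMap.toContinuousLinearMap
    { toFun := fun y ↦ inner ℂ v (toComplexVec y)
      map_add' := fun y z ↦ by
        rw [← inner_add_right]
        congr 1
        ext i
        simp [toComplexVec]
      map_smul' := fun c y ↦ by
        have : toComplexVec (c • y) = (c : ℂ) • toComplexVec y := by
          ext i
          simp [toComplexVec]
        rw [this, inner_smul_right]
        simp }

lemma complexCoord_apply (v : EuclideanSpace ℂ (Fin m)) (y : EuclideanSpace ℝ (Fin m)) :
    complexCoord v y = inner ℂ v (toComplexVec y) := rfl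

lemma inner_toComplexVec (x y : EuclideanSpace ℝ (Fin m)) :
    inner ℂ (toComplexVec x) (toComplexVec y) = (inner ℝ x y : ℝ) := by
  simp [PiLp.inner_apply, toComplexVec]

lemma sum_conj_complexCoord_mul (v : OrthonormalBasis (Fin m) ℂ (EuclideanSpace ℂ (Fin m)))
    (x y : EuclideanSpace ℝ (Fin m)) :
    ∑ j, star (complexCoord (v j) x) * complexCoord (v j) y = (inner ℝ x y : ℝ) := by
  rw [← inner_toComplexVec, ← v.sum_inner_mul_inner]
  refine Finset.sum_congr rfl fun j _ ↦ ?_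
  rw [complexCoord_apply, complexCoord_apply, ← inner_conj_symm]
  simp

lemma sum_norm_sq_complexCoord (v : OrthonormalBasis (Fin m) ℂ (EuclideanSpace ℂ (Fin m)))
    (y : EuclideanSpace ℝ (Fin m)) : ∑ j, ‖complexCoord (v j) y‖ ^ 2 = ‖y‖ ^ 2 := by
  have := sum_conj_complexCoord_mul v y y
  rw [real_inner_self_eq_norm_sq] at this
  rw [← Complex.ofReal_inj, ← this]
  push_cast
  refine Finset.sum_congr rfl fun j _ ↦ ?_
  rw [← Complex.conj_mul']
  rfl

lemma toEuclideanLin_toComplexVec (A : Matrix (Fin m) (Fin m) ℝ) (y : EuclideanSpace ℝ (Fin m)) :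
    (A.map (fun a : ℝ ↦ (a : ℂ))).toEuclideanLin (toComplexVec y) =
      toComplexVec (A.toEuclideanLin y) := by
  ext i
  simp [toComplexVec, Matrix.mulVec, dotProduct]

variable {A : Matrix (Fin m) (Fin m) ℝ} {l : Fin m → ℂ}
  {v : OrthonormalBasis (Fin m) ℂ (EuclideanSpace ℂ (Fin m))}

/-- Orthonormality of the eigenbasis is essential: it makes ⟨v_j, ·⟩ a left eigenfunctional for the
same eigenvalue. This is how normality acts in the proof. -/
lemma complexCoord_toEuclideanLin
    (hv : ∀ j, (A.map (fun a : ℝ ↦ (a : ℂ))).toEuclideanLin (v j) = l j • v j)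
    (j : Fin m) (y : EuclideanSpace ℝ (Fin m)) :
    complexCoord (v j) (A.toEuclideanLin y) = l j * complexCoord (v j) y := by
  rw [complexCoord_apply, ← toEuclideanLin_toComplexVec]
  conv_lhs => rw [← v.sum_repr (toComplexVec y)]
  simp only [map_sum, map_smul, hv, inner_sum, inner_smul_right,
    orthonormal_iff_ite.1 v.orthonormal, complexCoord_apply]
  simp [v.repr_apply_apply, mul_comm]

lemma complexCoord_toEuclideanLin_transpose
    (hv : ∀ j, (A.map (fun a : ℝ ↦ (a : ℂ))).toEuclideanLin (v j) = l j • v j)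
    (j : Fin m) (y : EuclideanSpace ℝ (Fin m)) :
    complexCoord (v j) (Aᵀ.toEuclideanLin y) = star (l j) * complexCoord (v j) y := by
  rw [complexCoord_apply, ← toEuclideanLin_toComplexVec]
  have h1 : Aᵀ.map (fun a : ℝ ↦ (a : ℂ)) = (A.map (fun a : ℝ ↦ (a : ℂ)))ᴴ := by
    ext a b
    simp
  rw [h1, Matrix.toEuclideanLin_conjTranspose_eq_adjoint, LinearMap.adjoint_inner_right, hv,
    inner_smul_left]
  rfl

end Coord

/-- Spectral data of `T + T*` relative to the complex eigenvectors of `T`. -/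
lemma exists_real_eigenbasis {m : ℕ} {T : EuclideanSpace ℝ (Fin m) →L[ℝ] EuclideanSpace ℝ (Fin m)}
    {l : Fin m → ℂ} {v : OrthonormalBasis (Fin m) ℂ (EuclideanSpace ℂ (Fin m))}
    (hT : ∀ j y, complexCoord (v j) (T y) = l j * complexCoord (v j) y)
    (hT' : ∀ j y, complexCoord (v j) (T.adjoint y) = star (l j) * complexCoord (v j) y) :
    ∃ (w : OrthonormalBasis (Fin m) ℝ (EuclideanSpace ℝ (Fin m))) (s : Fin m → ℝ),
      (∀ k, ∃ j, s k = 2 * (l j).re) ∧ (∀ j, ∃ k, s k = 2 * (l j).re) ∧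
      ∀ (f : ℝ → ℝ) (u : EuclideanSpace ℝ (Fin m)),
        ∑ j, f (2 * (l j).re) * ‖complexCoord (v j) u‖ ^ 2 = ∑ k, f (s k) * inner ℝ (w k) u ^ 2 := by
  have hS : ((T + T.adjoint : EuclideanSpace ℝ (Fin m) →L[ℝ] EuclideanSpace ℝ (Fin m)) :
      EuclideanSpace ℝ (Fin m) →ₗ[ℝ] EuclideanSpace ℝ (Fin m)).IsSymmetric := by
    intro x y
    simp [inner_add_left, inner_add_right, ContinuousLinearMap.adjoint_inner_left,
      ContinuousLinearMap.adjoint_inner_right, add_comm]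
  have hn : Module.finrank ℝ (EuclideanSpace ℝ (Fin m)) = m := by simp
  set w := hS.eigenvectorBasis hn with hw
  set s := hS.eigenvalues hn with hs
  have hSw : ∀ k, T (w k) + T.adjoint (w k) = s k • w k := fun k ↦ hS.apply_eigenvectorBasis hn k
  -- Each v_j is an eigenvector of T + T* for 2 Re l_j, so it can overlap only with those w_k that
  -- share this eigenvalue.
  have key : ∀ j k, complexCoord (v j) (w k) ≠ 0 → s k = 2 * (l j).re := by
    intro j k hjk
    have h := congrArg (complexCoord (v j)) (hSw k)
    rw [map_add, hT, hT', map_smul, ← add_mul, Complex.real_smul] at h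
    have h2 := mul_right_cancel₀ hjk h
    have h3 := congrArg Complex.re h2
    simp at h3
    linarith
  refine ⟨w, s, fun k ↦ ?_, fun j ↦ ?_, fun f u ↦ ?_⟩
  · by_contra! hne
    have h0 : ∀ j, complexCoord (v j) (w k) = 0 := fun j ↦ by
      by_contra h
      exact hne j (key j k h)
    have := sum_norm_sq_complexCoord v (w k)
    simp [h0] at this
  · by_contra! hne
    have h0 : ∀ k, complexCoord (v j) (w k) = 0 := fun k ↦ by
      by_contra h
      exact hne k (key j k h)
    have h1 : ∀ y, complexCoord (v j) y = 0 := fun y ↦ by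
      rw [← w.sum_repr y]
      simp [h0]
    have h2 : v j = 0 := by
      ext i
      have := h1 (EuclideanSpace.single i 1)
      rw [complexCoord_apply, PiLp.inner_apply, Finset.sum_eq_single i] at this
      · simpa [toComplexVec] using this
      · intro b _ hb
        simp [toComplexVec, hb]
      · simp
    exact (v.orthonormal.ne_zero j) h2
  -- R is f(T + T*)u. By `key` it acts in the complex coordinates as multiplication by f(2 Re l_j),
  -- and ⟨u, R⟩ is then computed in both bases.
  · set R : EuclideanSpace ℝ (Fin m) := ∑ k, (f (s k) * inner ℝ (w k) u) • w k with hR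
    have hLR : ∀ j, complexCoord (v j) R = f (2 * (l j).re) * complexCoord (v j) u := by
      intro j
      conv_rhs => rw [← w.sum_repr u]
      simp only [hR, map_sum, map_smul, Finset.mul_sum, w.repr_apply_apply, Complex.real_smul]
      refine Finset.sum_congr rfl fun k _ ↦ ?_
      by_cases h : complexCoord (v j) (w k) = 0
      · simp [h]
      · rw [key j k h]
        push_cast
        ring
    have h1 := sum_conj_complexCoord_mul v u R
    have h2 : inner ℝ u R = ∑ k, f (s k) * inner ℝ (w k) u ^ 2 := by
      simp only [hR, inner_sum, inner_smul_right]
      refine Finset.sum_congr rfl fun k _ ↦ ?_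
      rw [real_inner_comm]
      ring
    rw [← Complex.ofReal_inj, ← h2, ← h1]
    push_cast
    refine Finset.sum_congr rfl fun j _ ↦ ?_
    rw [hLR, ← Complex.conj_mul']
    simp only [RCLike.star_def]
    ring

/-! ### Gaussian laws diagonal in a fixed basis -/

section GaussianCharFun

variable {m : ℕ}

/-- The characteristic function of the Gaussian law with mean `a` and a covariance that is
diagonal, with entries `c`, in the orthonormal basis `w`. -/
noncomputable def diagGaussianCharFun (w : OrthonormalBasis (Fin m) ℝ (EuclideanSpace ℝ (Fin m)))
    (a : EuclideanSpace ℝ (Fin m)) (c : Fin m → ℝ) (u : EuclideanSpace ℝ (Fin m)) : ℂ :=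
  Complex.exp ((inner ℝ a u : ℝ) * Complex.I - ((∑ k, c k * inner ℝ (w k) u ^ 2) / 2 : ℝ))

variable {w : OrthonormalBasis (Fin m) ℝ (EuclideanSpace ℝ (Fin m))}
  {a : EuclideanSpace ℝ (Fin m)} {c : Fin m → ℝ} {ν : Measure (EuclideanSpace ℝ (Fin m))}
  [IsProbabilityMeasure ν]

/-- The characteristic function restricted to the line ℝe is that of the marginal along e. -/
lemma map_inner_eq_gaussianReal (hν : ∀ u, charFun ν u = diagGaussianCharFun w a c u)
    (hc : ∀ k, 0 ≤ c k) (e : EuclideanSpace ℝ (Fin m)) :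
    ν.map (fun z ↦ inner ℝ z e) =
      gaussianReal (inner ℝ a e) (∑ k, c k * inner ℝ (w k) e ^ 2).toNNReal := by
  have hm : Measurable fun z : EuclideanSpace ℝ (Fin m) ↦ (inner ℝ z e : ℝ) := by fun_prop
  have : IsProbabilityMeasure (ν.map (fun z ↦ (inner ℝ z e : ℝ))) :=
    Measure.isProbabilityMeasure_map hm.aemeasurable
  refine Measure.ext_of_charFun (funext fun r ↦ ?_)
  have h0 : 0 ≤ ∑ k, c k * inner ℝ (w k) e ^ 2 :=
    Finset.sum_nonneg fun k _ ↦ mul_nonneg (hc k) (sq_nonneg _)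
  have h1 := hν (r • e)
  rw [charFun_gaussianReal, charFun_apply_real, integral_map hm.aemeasurable (by fun_prop)]
  rw [charFun_apply] at h1
  simp only [inner_smul_right, Complex.ofReal_mul] at h1
  rw [h1, diagGaussianCharFun]
  congr 1
  rw [Real.coe_toNNReal _ h0]
  have h2 : ∑ k, c k * inner ℝ (w k) (r • e) ^ 2 = (∑ k, c k * inner ℝ (w k) e ^ 2) * r ^ 2 := by
    rw [Finset.sum_mul]
    refine Finset.sum_congr rfl fun k _ ↦ ?_
    rw [inner_smul_right]
    ring
  rw [h2, inner_smul_right]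
  push_cast
  ring

lemma hasLaw_inner (hν : ∀ u, charFun ν u = diagGaussianCharFun w a c u)
    (hc : ∀ k, 0 ≤ c k) (e : EuclideanSpace ℝ (Fin m)) :
    HasLaw (fun z ↦ inner ℝ z e)
      (gaussianReal (inner ℝ a e) (∑ k, c k * inner ℝ (w k) e ^ 2).toNNReal) ν :=
  ⟨by fun_prop, map_inner_eq_gaussianReal hν hc e⟩

lemma memLp_two_inner (hν : ∀ u, charFun ν u = diagGaussianCharFun w a c u)
    (hc : ∀ k, 0 ≤ c k) (e : EuclideanSpace ℝ (Fin m)) :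
    MemLp (fun z ↦ (inner ℝ z e : ℝ)) 2 ν :=
  (hasLaw_inner hν hc e).hasGaussianLaw.memLp_two

lemma integral_inner_right_eq (hν : ∀ u, charFun ν u = diagGaussianCharFun w a c u)
    (hc : ∀ k, 0 ≤ c k) (e : EuclideanSpace ℝ (Fin m)) :
    ∫ z, (inner ℝ z e : ℝ) ∂ν = inner ℝ a e := by
  rw [(hasLaw_inner hν hc e).integral_eq, integral_id_gaussianReal]

lemma integral_inner_sq (hν : ∀ u, charFun ν u = diagGaussianCharFun w 0 c u)
    (hc : ∀ k, 0 ≤ c k) (k : Fin m) :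
    ∫ z, (inner ℝ z (w k) : ℝ) ^ 2 ∂ν = c k := by
  have hl := hasLaw_inner hν hc (w k)
  have h := hl.variance_eq
  rw [variance_of_integral_eq_zero hl.aemeasurable
    (by rw [integral_inner_right_eq hν hc, inner_zero_left]), variance_id_gaussianReal] at h
  rw [h, Real.coe_toNNReal _
    (Finset.sum_nonneg fun k _ ↦ mul_nonneg (hc k) (sq_nonneg _)), Finset.sum_eq_single k]
  · simp
  · intro b _ hb
    simp [w.orthonormal.2 hb]
  · simp

end GaussianCharFun

/-! ### Upper and lower bounds for the Wasserstein distance -/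

lemma wasserstein_two_le {E : Type*} [PseudoEMetricSpace E] [MeasurableSpace E]
    {μ₁ μ₂ : Measure E} {γ : Measure (E × E)} (hγ : γ ∈ couplings μ₁ μ₂) {K : ℝ} (hK : 0 ≤ K)
    (h : ∫⁻ z, edist z.1 z.2 ^ (2 : ℝ) ∂γ ≤ ENNReal.ofReal (K ^ 2)) :
    wasserstein 2 μ₁ μ₂ ≤ ENNReal.ofReal K := by
  have h2 : min (1 : ℝ) (1 / 2) = 1 / 2 := by norm_num
  rw [wasserstein, h2]
  calc _ ≤ ENNReal.ofReal (K ^ 2) ^ (1 / 2 : ℝ) := by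
        gcongr
        exact (iInf₂_le γ hγ).trans h
    _ = ENNReal.ofReal K := by
        rw [ENNReal.ofReal_rpow_of_nonneg (by positivity) (by norm_num), ← Real.sqrt_eq_rpow,
          Real.sqrt_sq hK]

lemma le_wasserstein_two {E : Type*} [PseudoEMetricSpace E] [MeasurableSpace E]
    {μ₁ μ₂ : Measure E} {K : ℝ} (hK : 0 ≤ K)
    (h : ∀ γ ∈ couplings μ₁ μ₂, ENNReal.ofReal (K ^ 2) ≤ ∫⁻ z, edist z.1 z.2 ^ (2 : ℝ) ∂γ) :
    ENNReal.ofReal K ≤ wasserstein 2 μ₁ μ₂ := by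
  have h2 : min (1 : ℝ) (1 / 2) = 1 / 2 := by norm_num
  rw [wasserstein, h2]
  calc ENNReal.ofReal K = ENNReal.ofReal (K ^ 2) ^ (1 / 2 : ℝ) := by
        rw [ENNReal.ofReal_rpow_of_nonneg (by positivity) (by norm_num), ← Real.sqrt_eq_rpow,
          Real.sqrt_sq hK]
    _ ≤ _ := by
        gcongr
        exact le_iInf₂ h

/-- A lower bound of the transport cost by the cost in the direction `e`. -/
lemma ofReal_le_lintegral_edist_sq {E : Type*} [NormedAddCommGroup E] [InnerProductSpace ℝ E]
    [MeasurableSpace E] [BorelSpace E] [SecondCountableTopology E]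
    {γ : Measure (E × E)} {e : E}
    (hf : MemLp (fun z : E × E ↦ (inner ℝ z.1 e : ℝ)) 2 γ)
    (hg : MemLp (fun z : E × E ↦ (inner ℝ z.2 e : ℝ)) 2 γ) {K : ℝ}
    (he : e ≠ 0)
    (hK : K * ‖e‖ ^ 2 ≤ ∫ z, (inner ℝ z.1 e - inner ℝ z.2 e : ℝ) ^ 2 ∂γ) :
    ENNReal.ofReal K ≤ ∫⁻ z, edist z.1 z.2 ^ (2 : ℝ) ∂γ := by
  have he0 : 0 < ‖e‖ ^ 2 := by positivity
  have h1 : ENNReal.ofReal K * ENNReal.ofReal (‖e‖ ^ 2) ≤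
      (∫⁻ z, edist z.1 z.2 ^ (2 : ℝ) ∂γ) * ENNReal.ofReal (‖e‖ ^ 2) := by
    rw [← ENNReal.ofReal_mul' he0.le]
    refine (ENNReal.ofReal_le_ofReal hK).trans ?_
    have hd : Integrable (fun z : E × E ↦ (inner ℝ z.1 e - inner ℝ z.2 e : ℝ) ^ 2) γ :=
      (hf.sub hg).integrable_sq
    rw [ofReal_integral_eq_lintegral_ofReal hd
      (ae_of_all _ fun _ ↦ sq_nonneg _), ← lintegral_mul_const' _ _ ENNReal.ofReal_ne_top]
    refine lintegral_mono fun z ↦ ?_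
    dsimp only
    rw [edist_dist, ENNReal.ofReal_rpow_of_nonneg dist_nonneg (by norm_num),
      ← ENNReal.ofReal_mul' he0.le]
    refine ENNReal.ofReal_le_ofReal ?_
    rw [Real.rpow_two, dist_eq_norm, ← inner_sub_left, ← mul_pow]
    refine sq_le_sq' ?_ (real_inner_le_norm _ _)
    exact neg_le_of_neg_le (by rw [← inner_neg_left, ← norm_neg]; exact real_inner_le_norm _ _)
  exact (ENNReal.mul_le_mul_iff_left (by simpa using he) ENNReal.ofReal_ne_top).1 h1

section L2

variable {α : Type*} [MeasurableSpace α] {γ : Measure α} {f g : α → ℝ}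

/-- The variance of f - g is nonnegative. -/
lemma sq_integral_sub_le [IsProbabilityMeasure γ] (hf : MemLp f 2 γ) (hg : MemLp g 2 γ) :
    (∫ z, f z ∂γ - ∫ z, g z ∂γ) ^ 2 ≤ ∫ z, (f z - g z) ^ 2 ∂γ := by
  rw [← integral_sub (hf.integrable one_le_two) (hg.integrable one_le_two)]
  have h := variance_nonneg (f - g) γ
  rw [variance_eq_sub (hf.sub hg)] at h
  simpa using h

/-- A square-root-free substitute for the triangle inequality in L². The two integrands compared in
the proof differ by exactly ((1 + p/2)f - g)². The constant 1/6 is not sharp; only its positivity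
matters. -/
lemma le_integral_sub_sq_of_second_moments (hf : MemLp f 2 γ) (hg : MemLp g 2 γ) {V p : ℝ}
    (hp0 : 0 ≤ p) (hV : 0 ≤ V) (hf2 : ∫ z, f z ^ 2 ∂γ = (1 - p) * V)
    (hg2 : ∫ z, g z ^ 2 ∂γ = V) :
    V * p ^ 2 / 6 ≤ ∫ z, (f z - g z) ^ 2 ∂γ := by
  have hd : Integrable (fun z ↦ (f z - g z) ^ 2) γ := (hf.sub hg).integrable_sq
  have h : ∫ z, (p / 2) * g z ^ 2 ∂γ ≤
      ∫ z, ((p / 2) * (1 + p / 2)) * f z ^ 2 + (1 + p / 2) * (f z - g z) ^ 2 ∂γ := by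
    refine integral_mono (hg.integrable_sq.const_mul _)
      ((hf.integrable_sq.const_mul _).add (hd.const_mul _)) fun z ↦ ?_
    have := sq_nonneg ((1 + p / 2) * f z - g z)
    dsimp only
    nlinarith
  rw [integral_add (hf.integrable_sq.const_mul _) (hd.const_mul _), integral_const_mul,
    integral_const_mul, integral_const_mul, hf2, hg2] at h
  set D := ∫ z, (f z - g z) ^ 2 ∂γ
  have hpV : 0 ≤ p ^ 2 * V := by positivity
  have hpV3 : 0 ≤ p ^ 3 * V := by positivity
  have h1 : V * p ^ 2 / 4 ≤ (1 + p / 2) * D := by nlinarith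
  have hD : 0 ≤ D := integral_nonneg fun z ↦ sq_nonneg _
  nlinarith

end L2

section WassersteinBounds

variable {m : ℕ} {w : OrthonormalBasis (Fin m) ℝ (EuclideanSpace ℝ (Fin m))}
  {a : EuclideanSpace ℝ (Fin m)} {q c : Fin m → ℝ} {ν μ : Measure (EuclideanSpace ℝ (Fin m))}
  [IsProbabilityMeasure ν] [IsProbabilityMeasure μ]

lemma one_sub_sqrt_one_sub_sq_le {q p : ℝ} (h0 : 0 ≤ q) (h1 : q ≤ 1) (hp : q ≤ p) :
    (√(1 - q) - 1) ^ 2 ≤ p ^ 2 := by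
  have hs : √(1 - q) ≤ 1 := Real.sqrt_le_one.2 (by linarith)
  have hs' : 1 - q ≤ √(1 - q) := Real.le_sqrt_of_sq_le (by nlinarith)
  nlinarith

/-- The coupling is (a + Rz, z) with z distributed as μ, where R scales the direction w_k by √(1 -
q_k). Since |√(1 - q_k) - 1| ≤ q_k ≤ p, the displacement is at most |a| + p|z|. -/
lemma wasserstein_diagGaussian_le
    (hν : ∀ u, charFun ν u = diagGaussianCharFun w a (fun k ↦ (1 - q k) * c k) u)
    (hμ : ∀ u, charFun μ u = diagGaussianCharFun w 0 c u) (hc : ∀ k, 0 ≤ c k)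
    (hq0 : ∀ k, 0 ≤ q k) (hq1 : ∀ k, q k ≤ 1) {p : ℝ} (hp : 0 ≤ p) (hqp : ∀ k, q k ≤ p) :
    wasserstein 2 ν μ ≤ ENNReal.ofReal (2 * ‖a‖ + 2 * √(∑ k, c k) * p) := by
  set R : EuclideanSpace ℝ (Fin m) → EuclideanSpace ℝ (Fin m) :=
    fun z ↦ ∑ k, (√(1 - q k) * inner ℝ (w k) z) • w k with hR
  have hRc : Continuous R := by fun_prop
  have hwR : ∀ k z, inner ℝ (w k) (R z) = √(1 - q k) * inner ℝ (w k) z := by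
    intro k z
    simp [hR, inner_sum, inner_smul_right, orthonormal_iff_ite.1 w.orthonormal]
  -- Symmetry of R lets the characteristic function of the image law be read off from that of μ at R
  -- u.
  have hRs : ∀ z u, inner ℝ (R z) u = inner ℝ z (R u) := by
    intro z u
    rw [← w.sum_inner_mul_inner (R z) u, ← w.sum_inner_mul_inner z (R u)]
    refine Finset.sum_congr rfl fun k _ ↦ ?_
    rw [hwR, real_inner_comm, hwR, real_inner_comm (w k) z]
    ring
  set γ : Measure (EuclideanSpace ℝ (Fin m) × EuclideanSpace ℝ (Fin m)) :=
    μ.map (fun z ↦ (a + R z, z)) with hγ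
  have hFm : Measurable fun z ↦ (a + R z, z) := by
    have := hRc.measurable
    fun_prop
  have hγc : γ ∈ couplings ν μ := by
    constructor
    · rw [hγ, Measure.map_map measurable_fst hFm]
      have hm : Measurable fun z ↦ a + R z := by
        have := hRc.measurable
        fun_prop
      have : IsProbabilityMeasure (μ.map fun z ↦ a + R z) :=
        Measure.isProbabilityMeasure_map hm.aemeasurable
      refine Measure.ext_of_charFun (funext fun u ↦ ?_)
      change charFun (μ.map fun z ↦ a + R z) u = _
      have h1 := hμ (R u)
      rw [charFun_apply] at h1
      rw [hν, charFun_apply, integral_map hm.aemeasurable (by fun_prop)]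
      simp only [inner_add_left, hRs, Complex.ofReal_add, add_mul, Complex.exp_add]
      have h2 : ∑ k, c k * inner ℝ (w k) (R u) ^ 2 =
          ∑ k, (1 - q k) * c k * inner ℝ (w k) u ^ 2 := by
        refine Finset.sum_congr rfl fun k _ ↦ ?_
        rw [hwR, mul_pow, Real.sq_sqrt (by linarith [hq1 k])]
        ring
      rw [integral_const_mul, h1, diagGaussianCharFun, diagGaussianCharFun, ← Complex.exp_add, h2,
        inner_zero_left, Complex.ofReal_zero, zero_mul, zero_sub, sub_eq_add_neg]
    · rw [hγ, Measure.map_map measurable_snd hFm]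
      exact Measure.map_id
  refine wasserstein_two_le hγc (by positivity) ?_
  rw [hγ, lintegral_map (by fun_prop) hFm]
  have hint : ∀ k, Integrable (fun z ↦ (inner ℝ z (w k) : ℝ) ^ 2) μ := fun k ↦
    (memLp_two_inner hμ hc (w k)).integrable_sq
  have hpt : ∀ z, ‖a + R z - z‖ ^ 2 ≤ 2 * ‖a‖ ^ 2 + ∑ k, 2 * p ^ 2 * inner ℝ z (w k) ^ 2 := by
    intro z
    have h1 : ‖R z - z‖ ^ 2 ≤ ∑ k, p ^ 2 * inner ℝ z (w k) ^ 2 := by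
      rw [← w.sum_sq_norm_inner_right (R z - z)]
      refine Finset.sum_le_sum fun k _ ↦ ?_
      rw [inner_sub_right, hwR, real_inner_comm, ← sub_one_mul, Real.norm_eq_abs, sq_abs, mul_pow]
      exact mul_le_mul_of_nonneg_right (one_sub_sqrt_one_sub_sq_le (hq0 k) (hq1 k) (hqp k))
        (sq_nonneg _)
    have h2 : ‖a + R z - z‖ ≤ ‖a‖ + ‖R z - z‖ := by
      rw [add_sub_assoc]
      exact norm_add_le _ _
    have h3 : ∑ k, 2 * p ^ 2 * inner ℝ z (w k) ^ 2 = 2 * ∑ k, p ^ 2 * inner ℝ z (w k) ^ 2 := by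
      rw [Finset.mul_sum]
      exact Finset.sum_congr rfl fun k _ ↦ by ring
    rw [h3]
    nlinarith [norm_nonneg (a + R z - z), sq_nonneg (‖a‖ - ‖R z - z‖)]
  calc ∫⁻ z, edist (a + R z) z ^ (2 : ℝ) ∂μ
      ≤ ∫⁻ z, ENNReal.ofReal (2 * ‖a‖ ^ 2 + ∑ k, 2 * p ^ 2 * inner ℝ z (w k) ^ 2) ∂μ := by
        refine lintegral_mono fun z ↦ ?_
        rw [edist_dist, ENNReal.ofReal_rpow_of_nonneg dist_nonneg (by norm_num), Real.rpow_two,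
          dist_eq_norm]
        exact ENNReal.ofReal_le_ofReal (hpt z)
    _ = ENNReal.ofReal (∫ z, (2 * ‖a‖ ^ 2 + ∑ k, 2 * p ^ 2 * inner ℝ z (w k) ^ 2) ∂μ) := by
        rw [ofReal_integral_eq_lintegral_ofReal]
        · exact (integrable_const _).add (integrable_finsetSum _ fun k _ ↦ (hint k).const_mul _)
        · exact ae_of_all _ fun z ↦ by positivity
    _ ≤ _ := by
        refine ENNReal.ofReal_le_ofReal ?_
        rw [integral_add (integrable_const _) (integrable_finsetSum _ fun k _ ↦
          (hint k).const_mul _), integral_finsetSum _ fun k _ ↦ (hint k).const_mul _]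
        simp only [integral_const_mul, integral_inner_sq hμ hc, integral_const, probReal_univ,
          one_smul]
        rw [← Finset.mul_sum]
        have hS : 0 ≤ ∑ k, c k := Finset.sum_nonneg fun k _ ↦ hc k
        have hS2 := Real.sq_sqrt hS
        have h4 : 0 ≤ ‖a‖ * (√(∑ k, c k) * p) := by positivity
        have h5 : 0 ≤ p ^ 2 * ∑ k, c k := by positivity
        nlinarith [sq_nonneg ‖a‖]

lemma memLp_comp_of_map_eq {α β : Type*} [MeasurableSpace α] [MeasurableSpace β] {γ : Measure α}
    {ν : Measure β} {φ : α → β} (hφ : Measurable φ) (h : γ.map φ = ν) {f : β → ℝ}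
    (hf : MemLp f 2 ν) : MemLp (fun z ↦ f (φ z)) 2 γ := by
  subst h
  exact hf.comp_of_map hφ.aemeasurable

lemma isProbabilityMeasure_of_mem_couplings {E : Type*} [MeasurableSpace E] {μ₁ μ₂ : Measure E}
    [IsProbabilityMeasure μ₁] {γ : Measure (E × E)} (hγ : γ ∈ couplings μ₁ μ₂) :
    IsProbabilityMeasure γ := by
  have h := congrArg (fun ρ : Measure E ↦ ρ Set.univ) hγ.1
  simp only [measure_univ] at h
  rw [Measure.map_apply measurable_fst MeasurableSet.univ, Set.preimage_univ] at h
  exact ⟨h⟩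

/-- Any coupling is projected onto the direction of the mean a itself, where the two means differ by
|a|². -/
lemma norm_mean_le_wasserstein {c' : Fin m → ℝ}
    (hν : ∀ u, charFun ν u = diagGaussianCharFun w a c' u)
    (hμ : ∀ u, charFun μ u = diagGaussianCharFun w 0 c u) (hc : ∀ k, 0 ≤ c k)
    (hc' : ∀ k, 0 ≤ c' k) : ENNReal.ofReal ‖a‖ ≤ wasserstein 2 ν μ := by
  rcases eq_or_ne a 0 with ha | ha
  · simp [ha]
  refine le_wasserstein_two (norm_nonneg _) fun γ hγ ↦ ?_
  have := isProbabilityMeasure_of_mem_couplings hγ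
  have hf := memLp_comp_of_map_eq measurable_fst hγ.1 (memLp_two_inner hν hc' a)
  have hg := memLp_comp_of_map_eq measurable_snd hγ.2 (memLp_two_inner hμ hc a)
  refine ofReal_le_lintegral_edist_sq hf hg ha ?_
  refine le_trans (le_of_eq ?_) (sq_integral_sub_le hf hg)
  have h1 : ∫ z, (inner ℝ z.1 a : ℝ) ∂γ = inner ℝ a a := by
    rw [← integral_inner_right_eq hν hc' a, ← hγ.1,
      integral_map measurable_fst.aemeasurable (by fun_prop)]
  have h2 : ∫ z, (inner ℝ z.2 a : ℝ) ∂γ = 0 := by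
    rw [← inner_zero_left (𝕜 := ℝ) a, ← integral_inner_right_eq hμ hc a, ← hγ.2,
      integral_map measurable_snd.aemeasurable (by fun_prop)]
  rw [h1, h2, real_inner_self_eq_norm_sq]
  ring

/-- With equal means the distance is detected by the variances along w_k, which differ by the
relative defect q_k. -/
lemma sqrt_mul_le_wasserstein
    (hν : ∀ u, charFun ν u = diagGaussianCharFun w 0 (fun k ↦ (1 - q k) * c k) u)
    (hμ : ∀ u, charFun μ u = diagGaussianCharFun w 0 c u) (hc : ∀ k, 0 ≤ c k)
    (hq0 : ∀ k, 0 ≤ q k) (hq1 : ∀ k, q k ≤ 1) (k : Fin m) :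
    ENNReal.ofReal (√(c k / 6) * q k) ≤ wasserstein 2 ν μ := by
  have hc' : ∀ k, 0 ≤ (1 - q k) * c k := fun k ↦ mul_nonneg (by linarith [hq1 k]) (hc k)
  refine le_wasserstein_two (mul_nonneg (Real.sqrt_nonneg _) (hq0 k)) fun γ hγ ↦ ?_
  have hf := memLp_comp_of_map_eq measurable_fst hγ.1 (memLp_two_inner hν hc' (w k))
  have hg := memLp_comp_of_map_eq measurable_snd hγ.2 (memLp_two_inner hμ hc (w k))
  refine ofReal_le_lintegral_edist_sq hf hg (w.orthonormal.ne_zero k) ?_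
  have h1 : ∫ z, (inner ℝ z.1 (w k) : ℝ) ^ 2 ∂γ = (1 - q k) * c k := by
    rw [← integral_inner_sq hν hc' k, ← hγ.1,
      integral_map measurable_fst.aemeasurable (by fun_prop)]
  have h2 : ∫ z, (inner ℝ z.2 (w k) : ℝ) ^ 2 ∂γ = c k := by
    rw [← integral_inner_sq hμ hc k, ← hγ.2,
      integral_map measurable_snd.aemeasurable (by fun_prop)]
  refine le_trans (le_of_eq ?_) (le_integral_sub_sq_of_second_moments hf hg (hq0 k) (hc k) h1 h2)
  rw [w.norm_eq_one, mul_pow, Real.sq_sqrt (div_nonneg (hc k) (by norm_num))]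
  ring

end WassersteinBounds

/-! ### From exponential bounds to cutoff -/

/-- At time δ|ln ε|/r the exponential equals ε^δ, so the quotient is squeezed between multiples of
ε^(δ-1). -/
lemma cutoffStability_of_exp_bounds {d : ℝ≥0 → ℝ} {r c C : ℝ} (hr : 0 < r) (hc : 0 < c)
    (hlow : ∀ t : ℝ≥0, c * Real.exp (-(r * t)) ≤ d t)
    (hupp : ∀ t : ℝ≥0, d t ≤ C * Real.exp (-(r * t))) :
    CutoffStability d (fun ε ↦ 1 / r * |Real.log ε|) := by
  have hexp : ∀ δ : ℝ, 0 < δ → ∀ ε : ℝ, 0 < ε → ε < 1 →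
      Real.exp (-(r * ((δ * (1 / r * |Real.log ε|)).toNNReal : ℝ))) / ε = ε ^ (δ - 1) := by
    intro δ hδ ε h0 h1
    rw [Real.coe_toNNReal _ (by positivity), abs_of_neg (Real.log_neg h0 h1),
      Real.rpow_sub_one h0.ne', Real.rpow_def_of_pos h0]
    congr 2
    field_simp
  have hmem : ∀ᶠ ε : ℝ in 𝓝[>] 0, 0 < ε ∧ ε < 1 := Ioo_mem_nhdsGT one_pos
  refine ⟨fun δ h0 h1 ↦ ?_, fun δ h1 ↦ ?_⟩
  · have ht : Tendsto (fun ε : ℝ ↦ c * ε ^ (δ - 1)) (𝓝[>] 0) atTop :=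
      (tendsto_rpow_neg_nhdsGT_zero (by linarith)).const_mul_atTop hc
    refine tendsto_atTop_mono' _ ?_ ht
    filter_upwards [hmem] with ε hε
    rw [← hexp δ h0 ε hε.1 hε.2, ← mul_div_assoc]
    exact div_le_div_of_nonneg_right (hlow _) hε.1.le
  · have h0 : 0 < δ := one_pos.trans h1
    have ht : Tendsto (fun ε : ℝ ↦ C * ε ^ (δ - 1)) (𝓝[>] 0) (𝓝 0) := by
      have h2 : ContinuousAt (fun ε : ℝ ↦ ε ^ (δ - 1)) 0 :=
        Real.continuousAt_rpow_const _ _ (Or.inr (by linarith))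
      have h3 := (h2.tendsto.mono_left (nhdsWithin_le_nhds (s := Set.Ioi 0))).const_mul C
      rwa [Real.zero_rpow (by linarith), mul_zero] at h3
    refine tendsto_of_tendsto_of_tendsto_of_le_of_le' tendsto_const_nhds ht ?_ ?_
    · filter_upwards [hmem] with ε hε
      exact div_nonneg (le_trans (by positivity) (hlow _)) hε.1.le
    · filter_upwards [hmem] with ε hε
      rw [← hexp δ h0 ε hε.1 hε.2, ← mul_div_assoc]
      exact div_le_div_of_nonneg_right (hupp _) hε.1.le

/-! ### Laws of the process and of its equilibrium -/

/-- The convolution form of an invariance relation `∫ P_y μ(dy) = μ` in which `P_y` is the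
translate by `F y` of a fixed law `N`. -/
lemma charFun_eq_of_bind_translate_eq {E : Type*} [NormedAddCommGroup E] [InnerProductSpace ℝ E]
    [CompleteSpace E] [MeasurableSpace E] [BorelSpace E] [SecondCountableTopology E]
    {μ N : Measure E} [IsProbabilityMeasure μ] [IsProbabilityMeasure N] {κ : E → Measure E}
    {F : E →L[ℝ] E} (hκ : ∀ y, κ y = N.map (fun z ↦ F y + z)) (h : μ.bind κ = μ) (u : E) :
    charFun μ u = charFun μ (F.adjoint u) * charFun N u := by
  -- Measurability in the starting point comes for free: otherwise `bind` takes its default value 0,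
  -- which is not a probability measure.
  have hκm : AEMeasurable κ μ := by
    by_contra hn
    rw [Measure.bind, Measure.map_of_not_aemeasurable hn, Measure.join_zero] at h
    exact IsProbabilityMeasure.ne_zero μ h.symm
  have hF : IsProbabilityMeasure (μ.map F) :=
    Measure.isProbabilityMeasure_map F.measurable.aemeasurable
  have hconv : μ = (μ.map F) ∗ N := by
    conv_lhs => rw [← h]
    ext s hs
    rw [Measure.bind_apply hs hκm, ← lintegral_indicator_one hs,
      Measure.lintegral_conv (measurable_one.indicator hs),
      lintegral_map (by
        have := measurable_one (α := ℝ≥0∞).indicator hs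
        exact Measurable.lintegral_prod_right' (f := fun p : E × E ↦ s.indicator 1 (p.1 + p.2))
          (this.comp (by fun_prop))) F.measurable]
    refine lintegral_congr fun y ↦ ?_
    rw [hκ, ← lintegral_indicator_one hs, lintegral_map (measurable_one.indicator hs) (by fun_prop)]
  have hmap : charFun (μ.map F) u = charFun μ (F.adjoint u) := by
    rw [charFun_apply, charFun_apply, integral_map F.measurable.aemeasurable (by fun_prop)]
    simp_rw [ContinuousLinearMap.adjoint_inner_right]
  conv_lhs => rw [hconv]
  rw [charFun_conv, hmap]

section OU

variable {Ω : Type*} [MeasurableSpace Ω] {P : Measure Ω} [IsProbabilityMeasure P]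
  {m : ℕ} {A : Matrix (Fin m) (Fin m) ℝ}
  {T : EuclideanSpace ℝ (Fin m) →L[ℝ] EuclideanSpace ℝ (Fin m)}
  {w : OrthonormalBasis (Fin m) ℝ (EuclideanSpace ℝ (Fin m))} {s : Fin m → ℝ}
  {B : ℝ≥0 → Ω → EuclideanSpace ℝ (Fin m)}

lemma integral_norm_sq_decayFlow (hs : ∀ k, 0 < s k)
    (hTw : ∀ (t : ℝ) u, ‖decayFlow T.adjoint t u‖ ^ 2 =
      ∑ k, Real.exp (-(s k * t)) * inner ℝ (w k) u ^ 2) (t : ℝ) (u : EuclideanSpace ℝ (Fin m)) :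
    ∫ r in (0 : ℝ)..t, ‖decayFlow T.adjoint r u‖ ^ 2 =
      ∑ k, (1 - Real.exp (-(s k * t))) * (s k)⁻¹ * inner ℝ (w k) u ^ 2 := by
  simp_rw [hTw]
  have hd : ∀ r, HasDerivAt
      (fun r : ℝ ↦ ∑ k, -(Real.exp (-(s k * r))) * (s k)⁻¹ * inner ℝ (w k) u ^ 2)
      (∑ k, Real.exp (-(s k * r)) * inner ℝ (w k) u ^ 2) r := by
    intro r
    refine HasDerivAt.fun_sum fun k _ ↦ ?_
    have h1 := ((((hasDerivAt_id r).const_mul (s k)).fun_neg.exp.fun_neg.mul_const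
      (s k)⁻¹).mul_const (inner ℝ (w k) u ^ 2))
    refine h1.congr_deriv ?_
    have := (hs k).ne'
    simp only [id]
    field_simp
  rw [intervalIntegral.integral_eq_sub_of_hasDerivAt (fun r _ ↦ hd r)
    (Continuous.intervalIntegrable (by fun_prop) _ _), ← Finset.sum_sub_distrib]
  refine Finset.sum_congr rfl fun k _ ↦ ?_
  simp
  ring

lemma IsOUSolution.charFun_map_eq_diagGaussian (hB : IsStandardBrownian B P)
    {x : EuclideanSpace ℝ (Fin m)} {X : ℝ≥0 → Ω → EuclideanSpace ℝ (Fin m)}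
    (hX : IsOUSolution A (1 : Matrix (Fin m) (Fin m) ℝ) B P x X)
    (hT : ∀ y, A.toEuclideanLin y = T y) (hs : ∀ k, 0 < s k)
    (hTw : ∀ (t : ℝ) u, ‖decayFlow T.adjoint t u‖ ^ 2 =
      ∑ k, Real.exp (-(s k * t)) * inner ℝ (w k) u ^ 2) (t : ℝ≥0) (u : EuclideanSpace ℝ (Fin m)) :
    charFun (P.map (X t)) u = diagGaussianCharFun w (decayFlow T t x)
      (fun k ↦ (1 - Real.exp (-(s k * t))) * (s k)⁻¹) u := by
  rw [hX.charFun_map hB hT, integral_norm_sq_decayFlow hs hTw, diagGaussianCharFun]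

/-- X_t(y) has the law of X_t(0) translated by S_t y, so invariance reads φ_μ(u) = φ_μ(S_t* u)
φ_{X_t(0)}(u). As t → ∞, S_t* u → 0 and the first factor tends to 1. No moments of μ are required.
-/
lemma IsStationaryLaw.charFun_eq_diagGaussian (hB : IsStandardBrownian B P)
    {X : EuclideanSpace ℝ (Fin m) → ℝ≥0 → Ω → EuclideanSpace ℝ (Fin m)}
    (hX : ∀ y, IsOUSolution A (1 : Matrix (Fin m) (Fin m) ℝ) B P y (X y))
    {μ : Measure (EuclideanSpace ℝ (Fin m))} (hμ : IsStationaryLaw P X μ)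
    (hT : ∀ y, A.toEuclideanLin y = T y) (hs : ∀ k, 0 < s k)
    (hTw : ∀ (t : ℝ) u, ‖decayFlow T.adjoint t u‖ ^ 2 =
      ∑ k, Real.exp (-(s k * t)) * inner ℝ (w k) u ^ 2) (u : EuclideanSpace ℝ (Fin m)) :
    charFun μ u = diagGaussianCharFun w 0 (fun k ↦ (s k)⁻¹) u := by
  have := hμ.isProbabilityMeasure
  have hexp : ∀ k, Tendsto (fun t : ℝ≥0 ↦ Real.exp (-(s k * t))) atTop (𝓝 0) := fun k ↦
    Real.tendsto_exp_neg_atTop_nhds_zero.comp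
      (((NNReal.tendsto_coe_atTop.2 tendsto_id).const_mul_atTop (hs k)))
  have hrel : ∀ t : ℝ≥0, charFun μ u = charFun μ (decayFlow T.adjoint t u) *
      diagGaussianCharFun w 0 (fun k ↦ (1 - Real.exp (-(s k * t))) * (s k)⁻¹) u := by
    intro t
    have hp : ∀ y, IsProbabilityMeasure (P.map (X y t)) := fun y ↦
      Measure.isProbabilityMeasure_map ((hX y).aemeasurable t)
    have h0 := fun u ↦ (hX 0).charFun_map_eq_diagGaussian hB hT hs hTw t u
    rw [map_zero] at h0
    rw [← h0, ← adjoint_decayFlow]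
    refine charFun_eq_of_bind_translate_eq (fun y ↦ ?_) (hμ.bind_eq t) u
    have : IsProbabilityMeasure ((P.map (X 0 t)).map fun z ↦ decayFlow T t y + z) :=
      Measure.isProbabilityMeasure_map (by fun_prop)
    refine Measure.ext_of_charFun (funext fun u ↦ ?_)
    rw [charFun_map_const_add, h0, (hX y).charFun_map_eq_diagGaussian hB hT hs hTw,
      diagGaussianCharFun, diagGaussianCharFun, ← Complex.exp_add]
    congr 1
    rw [inner_zero_left, real_inner_comm]
    simp
    ring
  have hlim0 : Tendsto (fun t : ℝ≥0 ↦ decayFlow T.adjoint t u) atTop (𝓝 0) := by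
    rw [tendsto_zero_iff_norm_tendsto_zero]
    have h1 : Tendsto (fun t : ℝ≥0 ↦ ‖decayFlow T.adjoint t u‖ ^ 2) atTop (𝓝 0) := by
      simp_rw [hTw]
      have := tendsto_finsetSum (Finset.univ : Finset (Fin m))
        fun k _ ↦ (hexp k).mul_const (inner ℝ (w k) u ^ 2)
      simpa using this
    have h2 := (Real.continuous_sqrt.tendsto 0).comp h1
    simpa [Function.comp_def] using h2
  have hlim1 : Tendsto (fun t : ℝ≥0 ↦ charFun μ (decayFlow T.adjoint t u)) atTop (𝓝 1) := by
    have h1 := ((continuous_charFun (μ := μ)).tendsto 0).comp hlim0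
    simpa [charFun_zero, Function.comp_def] using h1
  have hlim2 : Tendsto (fun t : ℝ≥0 ↦
      diagGaussianCharFun w 0 (fun k ↦ (1 - Real.exp (-(s k * t))) * (s k)⁻¹) u) atTop
      (𝓝 (diagGaussianCharFun w 0 (fun k ↦ (s k)⁻¹) u)) := by
    have h1 : Tendsto (fun t : ℝ≥0 ↦
        ∑ k, (1 - Real.exp (-(s k * t))) * (s k)⁻¹ * inner ℝ (w k) u ^ 2) atTop
        (𝓝 (∑ k, (s k)⁻¹ * inner ℝ (w k) u ^ 2)) := by
      refine tendsto_finsetSum _ fun k _ ↦ ?_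
      have := (((hexp k).const_sub 1).mul_const (s k)⁻¹).mul_const (inner ℝ (w k) u ^ 2)
      simpa using this
    have hc : Continuous fun r : ℝ ↦
        Complex.exp ((inner ℝ (0 : EuclideanSpace ℝ (Fin m)) u : ℝ) * Complex.I - (r / 2 : ℝ)) := by
      fun_prop
    exact (hc.tendsto _).comp h1
  have hlim := (hlim1.mul hlim2).congr fun t ↦ (hrel t).symm
  rw [one_mul] at hlim
  exact tendsto_nhds_unique tendsto_const_nhds hlim

end OU

/-! ### Decay of the mean and conclusion -/

lemma norm_sq_decayFlow_eq_sum {m : ℕ}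
    {T : EuclideanSpace ℝ (Fin m) →L[ℝ] EuclideanSpace ℝ (Fin m)} {l : Fin m → ℂ}
    {v : OrthonormalBasis (Fin m) ℂ (EuclideanSpace ℂ (Fin m))}
    (hT : ∀ j y, complexCoord (v j) (T y) = l j * complexCoord (v j) y) (t : ℝ)
    (x : EuclideanSpace ℝ (Fin m)) :
    ‖decayFlow T t x‖ ^ 2 =
      ∑ j, Real.exp (-(2 * (l j).re * t)) * ‖complexCoord (v j) x‖ ^ 2 := by
  rw [← sum_norm_sq_complexCoord v]
  exact Finset.sum_congr rfl fun j _ ↦ norm_sq_apply_decayFlow_of_eigen (hT j) t x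

/-- Only the eigendirections on which x has a nonzero coordinate contribute, so they alone determine
the rate. -/
lemma norm_decayFlow_le {m : ℕ} {T : EuclideanSpace ℝ (Fin m) →L[ℝ] EuclideanSpace ℝ (Fin m)}
    {l : Fin m → ℂ} {v : OrthonormalBasis (Fin m) ℂ (EuclideanSpace ℂ (Fin m))}
    (hT : ∀ j y, complexCoord (v j) (T y) = l j * complexCoord (v j) y) {t ρ : ℝ} (ht : 0 ≤ t)
    {x : EuclideanSpace ℝ (Fin m)} (hρ : ∀ j, complexCoord (v j) x ≠ 0 → ρ ≤ (l j).re) :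
    ‖decayFlow T t x‖ ≤ ‖x‖ * Real.exp (-(ρ * t)) := by
  refine (pow_le_pow_iff_left₀ (by positivity) (by positivity) two_ne_zero).1 ?_
  rw [norm_sq_decayFlow_eq_sum hT, mul_pow, ← sum_norm_sq_complexCoord v x, Finset.sum_mul,
    ← Real.exp_nat_mul]
  refine Finset.sum_le_sum fun j _ ↦ ?_
  rw [mul_comm]
  by_cases hj : complexCoord (v j) x = 0
  · simp [hj]
  · refine mul_le_mul_of_nonneg_left (Real.exp_le_exp.2 ?_) (sq_nonneg _)
    have := mul_le_mul_of_nonneg_right (hρ j hj) ht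
    push_cast
    linarith

lemma le_norm_decayFlow {m : ℕ} {T : EuclideanSpace ℝ (Fin m) →L[ℝ] EuclideanSpace ℝ (Fin m)}
    {l : Fin m → ℂ} {v : OrthonormalBasis (Fin m) ℂ (EuclideanSpace ℂ (Fin m))}
    (hT : ∀ j y, complexCoord (v j) (T y) = l j * complexCoord (v j) y) (t : ℝ)
    (x : EuclideanSpace ℝ (Fin m)) (j : Fin m) :
    ‖complexCoord (v j) x‖ * Real.exp (-((l j).re * t)) ≤ ‖decayFlow T t x‖ := by
  refine (pow_le_pow_iff_left₀ (by positivity) (by positivity) two_ne_zero).1 ?_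
  rw [norm_sq_decayFlow_eq_sum hT, mul_pow, ← Real.exp_nat_mul]
  refine le_trans (le_of_eq ?_) (Finset.single_le_sum
    (f := fun j ↦ Real.exp (-(2 * (l j).re * t)) * ‖complexCoord (v j) x‖ ^ 2)
    (fun i _ ↦ by positivity) (Finset.mem_univ j))
  rw [mul_comm]
  congr 2
  push_cast
  ring

theorem corollary3 {Ω : Type*} [MeasurableSpace Ω] (P : Measure Ω) [IsProbabilityMeasure P]
    {m : ℕ} [NeZero m]
    -- the drift matrix: normal, with eigenvalues `l j` and orthonormal eigenvectors `v j`
    (A : Matrix (Fin m) (Fin m) ℝ) (hA : A * Aᵀ = Aᵀ * A)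
    (l : Fin m → ℂ) (v : OrthonormalBasis (Fin m) ℂ (EuclideanSpace ℂ (Fin m)))
    (hv : ∀ j, (A.map (fun a : ℝ ↦ (a : ℂ))).toEuclideanLin (v j) = l j • v j)
    (hl : Monotone (fun j ↦ (l j).re)) (hpos : 0 < (l 0).re)
    -- the Ornstein-Uhlenbeck process with dispersion matrix the identity, from every initial value
    (B : ℝ≥0 → Ω → EuclideanSpace ℝ (Fin m)) (hB : IsStandardBrownian B P)
    (X : EuclideanSpace ℝ (Fin m) → ℝ≥0 → Ω → EuclideanSpace ℝ (Fin m))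
    (hX : ∀ y, IsOUSolution A (1 : Matrix (Fin m) (Fin m) ℝ) B P y (X y))
    -- its equilibrium distribution
    (μ : Measure (EuclideanSpace ℝ (Fin m))) (hμ : IsStationaryLaw P X μ)
    (x : EuclideanSpace ℝ (Fin m)) :
    (∀ t, wasserstein 2 (P.map (X x t)) μ ≠ ∞) ∧
    (x ≠ 0 → inner ℂ (toComplexVec x) (v 0) ≠ 0 →
      CutoffStability (fun t ↦ (wasserstein 2 (P.map (X x t)) μ).toReal)
        (fun ε ↦ 1 / (l 0).re * |Real.log ε|)) ∧
    (x ≠ 0 → inner ℂ (toComplexVec x) (v 0) = 0 →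
      ∀ ρ : ℝ, IsLeast {r : ℝ | ∃ j, inner ℂ (toComplexVec x) (v j) ≠ 0 ∧ (l j).re = r} ρ →
      ρ < 2 * (l 0).re →
      CutoffStability (fun t ↦ (wasserstein 2 (P.map (X x t)) μ).toReal)
        (fun ε ↦ 1 / ρ * |Real.log ε|)) ∧
    (x = 0 →
      CutoffStability (fun t ↦ (wasserstein 2 (P.map (X x t)) μ).toReal)
        (fun ε ↦ 1 / (2 * (l 0).re) * |Real.log ε|)) := by
  set T : EuclideanSpace ℝ (Fin m) →L[ℝ] EuclideanSpace ℝ (Fin m) :=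
    Matrix.toEuclideanCLM (n := Fin m) (𝕜 := ℝ) A with hTdef
  have hT : ∀ y, A.toEuclideanLin y = T y := fun y ↦ rfl
  have hT' : ∀ y, Aᵀ.toEuclideanLin y = T.adjoint y := by
    intro y
    have : T.adjoint = Matrix.toEuclideanCLM (n := Fin m) (𝕜 := ℝ) Aᵀ := by
      rw [← ContinuousLinearMap.star_eq_adjoint, hTdef, ← map_star, Matrix.star_eq_conjTranspose,
        Matrix.conjTranspose_eq_transpose_of_trivial]
    rw [this]
    rfl
  have hLT : ∀ j y, complexCoord (v j) (T y) = l j * complexCoord (v j) y := fun j y ↦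
    complexCoord_toEuclideanLin hv j y
  have hLT' : ∀ j y, complexCoord (v j) (T.adjoint y) = star (l j) * complexCoord (v j) y :=
    fun j y ↦ by rw [← hT']; exact complexCoord_toEuclideanLin_transpose hv j y
  obtain ⟨w, s, hsl, hls, hsum⟩ := exists_real_eigenbasis hLT hLT'
  have hl0 : ∀ j, (l 0).re ≤ (l j).re := fun j ↦ hl (Fin.zero_le j)
  have hsge : ∀ k, 2 * (l 0).re ≤ s k := fun k ↦ by
    obtain ⟨j, hj⟩ := hsl k
    rw [hj]
    linarith [hl0 j]
  have hs : ∀ k, 0 < s k := fun k ↦ by linarith [hsge k]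
  -- T* has the conjugate eigenvalues, with the same real parts; the sum over v_j is moved to the
  -- real basis with f(r) = exp(-rt).
  have hTw : ∀ (t : ℝ) u, ‖decayFlow T.adjoint t u‖ ^ 2 =
      ∑ k, Real.exp (-(s k * t)) * inner ℝ (w k) u ^ 2 := fun t u ↦ by
    rw [norm_sq_decayFlow_eq_sum hLT', ← hsum (fun r ↦ Real.exp (-(r * t)))]
    simp
  have hμp := hμ.isProbabilityMeasure
  have hνp : ∀ t, IsProbabilityMeasure (P.map (X x t)) := fun t ↦
    Measure.isProbabilityMeasure_map ((hX x).aemeasurable t)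
  have hμc := fun u ↦ hμ.charFun_eq_diagGaussian hB hX hT hs hTw u
  have hνc := fun t u ↦ (hX x).charFun_map_eq_diagGaussian hB hT hs hTw t u
  have hc : ∀ k, 0 ≤ (s k)⁻¹ := fun k ↦ (inv_pos.2 (hs k)).le
  have hq0 : ∀ (t : ℝ≥0) k, 0 ≤ Real.exp (-(s k * t)) := fun t k ↦ (Real.exp_pos _).le
  have hq1 : ∀ (t : ℝ≥0) k, Real.exp (-(s k * t)) ≤ 1 := fun t k ↦
    Real.exp_le_one_iff.2 (neg_nonpos.2 (mul_nonneg (hs k).le t.coe_nonneg))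
  have hqp : ∀ (t : ℝ≥0) k, Real.exp (-(s k * t)) ≤ Real.exp (-(2 * (l 0).re * t)) := fun t k ↦
    Real.exp_le_exp.2 (neg_le_neg (mul_le_mul_of_nonneg_right (hsge k) t.coe_nonneg))
  have hupp : ∀ t : ℝ≥0, wasserstein 2 (P.map (X x t)) μ ≤ ENNReal.ofReal
      (2 * ‖decayFlow T t x‖ + 2 * √(∑ k, (s k)⁻¹) * Real.exp (-(2 * (l 0).re * t))) := fun t ↦
    wasserstein_diagGaussian_le (hνc t) hμc hc (hq0 t) (hq1 t) (Real.exp_pos _).le (hqp t)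
  have hfin : ∀ t, wasserstein 2 (P.map (X x t)) μ ≠ ∞ := fun t ↦
    ne_top_of_le_ne_top ENNReal.ofReal_ne_top (hupp t)
  have hupp' : ∀ t : ℝ≥0, (wasserstein 2 (P.map (X x t)) μ).toReal ≤
      2 * ‖decayFlow T t x‖ + 2 * √(∑ k, (s k)⁻¹) * Real.exp (-(2 * (l 0).re * t)) := fun t ↦
    ENNReal.toReal_le_of_le_ofReal (by positivity) (hupp t)
  have hlow : ∀ t : ℝ≥0, ‖decayFlow T t x‖ ≤ (wasserstein 2 (P.map (X x t)) μ).toReal := fun t ↦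
    (ENNReal.ofReal_le_iff_le_toReal (hfin t)).1 (norm_mean_le_wasserstein (hνc t) hμc hc
      fun k ↦ mul_nonneg (sub_nonneg.2 (hq1 t k)) (hc k))
  -- Common to cases 1 and 2: when ρ ≤ 2 Re λ₁, the covariance error decays at least as fast as the
  -- mean.
  have hmean : ∀ ρ : ℝ, 0 < ρ → ρ ≤ 2 * (l 0).re →
      (∀ j, complexCoord (v j) x ≠ 0 → ρ ≤ (l j).re) →
      (∃ j, complexCoord (v j) x ≠ 0 ∧ (l j).re = ρ) →
      CutoffStability (fun t ↦ (wasserstein 2 (P.map (X x t)) μ).toReal)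
        (fun ε ↦ 1 / ρ * |Real.log ε|) := by
    rintro ρ hρ hρ2 hρle ⟨j, hj, hjρ⟩
    refine cutoffStability_of_exp_bounds (c := ‖complexCoord (v j) x‖)
      (C := 2 * ‖x‖ + 2 * √(∑ k, (s k)⁻¹)) hρ (norm_pos_iff.2 hj) (fun t ↦ ?_) fun t ↦ ?_
    · rw [← hjρ]
      exact (le_norm_decayFlow hLT t x j).trans (hlow t)
    · have h1 := norm_decayFlow_le hLT t.coe_nonneg hρle
      have h2 : Real.exp (-(2 * (l 0).re * t)) ≤ Real.exp (-(ρ * t)) :=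
        Real.exp_le_exp.2 (neg_le_neg (mul_le_mul_of_nonneg_right hρ2 t.coe_nonneg))
      have h3 := mul_le_mul_of_nonneg_left h2
        (by positivity : 0 ≤ 2 * √(∑ k, (s k)⁻¹))
      refine (hupp' t).trans ?_
      rw [add_mul]
      linarith
  have hinner : ∀ j, inner ℂ (toComplexVec x) (v j) ≠ 0 ↔ complexCoord (v j) x ≠ 0 := fun j ↦ by
    rw [complexCoord_apply, Ne, Ne, inner_eq_zero_symm]
  refine ⟨hfin, fun _ h0 ↦ ?_, fun _ _ ρ hρ hρ2 ↦ ?_, fun hx ↦ ?_⟩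
  · exact hmean _ hpos (by linarith) (fun j _ ↦ hl0 j) ⟨0, (hinner 0).1 h0, rfl⟩
  · obtain ⟨⟨j, hj, hjρ⟩, hmin⟩ := hρ
    exact hmean ρ (hjρ ▸ hpos.trans_le (hl0 j)) hρ2.le
      (fun i hi ↦ hmin ⟨i, (hinner i).2 hi, rfl⟩) ⟨j, (hinner j).1 hj, hjρ⟩
  · have h0 : ∀ t : ℝ≥0, decayFlow T t x = 0 := fun t ↦ by rw [hx, map_zero]
    -- With zero mean only the covariance matters; this k is a real direction with the slowest rate
    -- s_k = 2 Re λ₁, matching the upper bound.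
    obtain ⟨k, hk⟩ := hls 0
    refine cutoffStability_of_exp_bounds (c := √((s k)⁻¹ / 6)) (C := 2 * √(∑ k, (s k)⁻¹))
      (by linarith) (Real.sqrt_pos.2 (div_pos (inv_pos.2 (hs k)) (by norm_num)))
      (fun t ↦ ?_) fun t ↦ ?_
    · rw [← hk]
      refine (ENNReal.ofReal_le_iff_le_toReal (hfin t)).1 ?_
      have hν0 := hνc t
      rw [h0] at hν0
      exact sqrt_mul_le_wasserstein hν0 hμc hc (hq0 t) (hq1 t) k
    · have := hupp' t
      rwa [h0, norm_zero, mul_zero, zero_add] at this
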